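/- For $k\ge 2$ and $n\ge 0$ let $$J_k(n)=\sum_{r=1}^{k-1}2^k\int_{[0,1]^k}\frac{(1-u_1^4\cdots u_r^4)^n(1-u_{r+1}^4\cdots u_k^4)^n}{(1-u_1^2\cdots u_k^2)^{2n+1}}\,du_1\cdots du_k$$ be the Apéry-like numbers, $w_k(z)=\sum_{n\ge0}J_k(n)z^n$ their generating functions, and let $v_k$ be the analytic continuation to $\mathbb C\setminus[1,\infty)$ of the function $t\mapsto(1-z)\,w_k(z)$, $z=\frac{t}{t-1}$, which is given near $t=0$. The even meta-generating function is $$V^e(t,\lambda)=\sum_{k=0}^\infty v_{2k+2}(t)(-1)^k\lambda^{2k}.$$ Let ${}_2F_1(a,b;1;t)$ denote the principal branch of the hypergeometric function on $\mathbb C\setminus[1,\infty)$. For $l=2,3,4,6$ put $C_2=2^4$, $C_3=3^3$, $C_4=2^6$, $C_6=2^43^3$, $$P_2=x+\tfrac1x+y+\tfrac1y,\quad P_3=\tfrac{x^2}y+\tfrac{y^2}x+\tfrac1{xy},\quad P_4=xy^2+\tfrac x{y^2}+\tfrac1x,\quad P_6=\tfrac{x^2}y-\tfrac yx-\tfrac1{xy},$$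 $$u_l(\lambda)=\frac1{(2\pi i)^2}\int_{\mathbb T^2}\frac1{1-\lambda P_l(x,y)}\frac{dx}x\frac{dy}y,\qquad \mathbb T^2=\{(x,y)\in\mathbb C^2:|x|=|y|=1\},$$ and let $D_l$ be the connected component containing $0$ of the set of $\lambda\in\mathbb C$ for which $1-\lambda P_l$ has no zero on $\mathbb T^2$ (in particular $D_2$ contains the disc $|\lambda|<\frac14$ and $D_3,D_4,D_6$ contain the disc $|\lambda|<\frac13$). **Corollary 4.2 (Mahler measure relation).** (a) The series $w_{2k+2}(z)$ converges for $|z|<1$; the continuation $v_{2k+2}$ to $\mathbb C\setminus[1,\infty)$ exists, and $v_{2k+2}(t)=(1-z)w_{2k+2}(z)$ with $z=\frac t{t-1}$ whenever $\operatorname{Re}t<\frac12$, that is, whenever $|z|<1$ ($k\ge0$). (b) For $t\in\mathbb C\setminus[1,\infty)$ and $\lambda\in\mathbb C$ with $|\lambda|<\frac12$ the series $V^e(t,\lambda)$ converges absolutely and $$V^e(t,\lambda)=\frac{\pi^2}{2\cosh^2\pi\lambda}\;{}_2F_1\Bigl(\tfrac12+i\lambda,\tfrac12-i\lambda;1;t\Bigr).$$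 (c) For $l=2,3,4,6$ and $\lambda\in D_l$ one has $C_l\lambda^l\notin[1,\infty)$ and $$V^e\Bigl(C_l\lambda^l,\tfrac1i\bigl(\tfrac12-\tfrac1l\bigr)\Bigr)=\frac{\pi^2}{2\sin^2(\pi/l)}\,u_l(\lambda).$$ -/

import Mathlib

open MeasureTheory Set Filter Topology

namespace NcHO

/-! ### The Apéry-like numbers and their generating functions -/

/-- The integral
`2 ^ (r + s) ∫ (1 - u₁⁴ ⋯ u_r⁴) ^ n (1 - u_{r+1}⁴ ⋯ u_{r+s}⁴) ^ n / (1 - u₁² ⋯ u_{r+s}²) ^ (2n+1) du`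
over the cube `[0,1] ^ (r + s)`, the point of the cube being written as
`(p.1, p.2)` in `[0,1] ^ r × [0,1] ^ s`. -/
noncomputable def cubeIntegral (r s n : ℕ) : ℝ :=
  (2 : ℝ) ^ (r + s) *
    ∫ p in (Icc 0 1 : Set ((Fin r → ℝ) × (Fin s → ℝ))),
      (1 - ∏ i, p.1 i ^ 4) ^ n * (1 - ∏ j, p.2 j ^ 4) ^ n /
        (1 - (∏ i, p.1 i ^ 2) * ∏ j, p.2 j ^ 2) ^ (2 * n + 1)

/-- The `k`-th Apéry-like numbers `J_k(n)` for `k ≥ 2`, as the sum over `1 ≤ r ≤ k - 1` of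
the integrals over `[0,1] ^ k` above. -/
noncomputable def J (k n : ℕ) : ℝ :=
  ∑ r ∈ Finset.Ico 1 k, cubeIntegral r (k - r) n

/-- The generating function `w_k(z) = ∑ J_k(n) z ^ n` (for `|z| < 1`). -/
noncomputable def w (k : ℕ) (z : ℂ) : ℂ :=
  ∑' n : ℕ, (J k n : ℂ) * z ^ n

/-- `(1 - z) w_k(z)` with `z = t / (t - 1)`; the power series in `z` converges for `Re t < 1/2`. -/
noncomputable def vLocal (k : ℕ) (t : ℂ) : ℂ :=
  (1 - t / (t - 1)) * w k (t / (t - 1))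

/-! ### Analytic continuation to the cut plane `ℂ ∖ [1, ∞)` -/

/-- The cut plane `ℂ ∖ [1, ∞)`. -/
def cutPlane : Set ℂ := {t | ¬ (1 ≤ t.re ∧ t.im = 0)}

/-- `F` is an analytic continuation to `ℂ ∖ [1, ∞)` of the germ of `f` at `0`. -/
def IsContinuation (f F : ℂ → ℂ) : Prop :=
  AnalyticOnNhd ℂ F cutPlane ∧ F =ᶠ[𝓝 0] f

open Classical in
/-- The analytic continuation to `ℂ ∖ [1, ∞)` of the germ of `f` at `0`, if there is one
(it is then unique there, see `principalBranch_eq`); the zero function if there is none. -/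
noncomputable def principalBranch (f : ℂ → ℂ) : ℂ → ℂ :=
  if h : ∃ F, IsContinuation f F then h.choose else 0

theorem isPreconnected_cutPlane : IsPreconnected cutPlane := by
  have h0 : (0 : ℂ) ∈ cutPlane := by
    rintro ⟨h1, -⟩
    norm_num at h1
  have h : StarConvex ℝ (0 : ℂ) cutPlane := by
    rw [starConvex_zero_iff]
    intro x hx a ha0 ha1 hc
    apply hx
    have h1 : 1 ≤ a * x.re := by simpa using hc.1
    have h2 : a * x.im = 0 := by simpa using hc.2
    have ha : 0 < a := by
      rcases ha0.eq_or_lt with rfl | ha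
      · norm_num at h1
      · exact ha
    exact ⟨by nlinarith, (mul_eq_zero.mp h2).resolve_left ha.ne'⟩
  exact (h.isPathConnected h0).isConnected.isPreconnected

theorem principalBranch_eq {f F : ℂ → ℂ} (h : IsContinuation f F) :
    EqOn (principalBranch f) F cutPlane := by
  have hex : ∃ F, IsContinuation f F := ⟨F, h⟩
  have hs : IsContinuation f (principalBranch f) := by
    rw [principalBranch, dif_pos hex]
    exact hex.choose_spec
  exact hs.1.eqOn_of_preconnected_of_eventuallyEq h.1 isPreconnected_cutPlane
    (z₀ := 0) (fun h0 => by have := h0.1; norm_num at this) (hs.2.trans h.2.symm)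

/-- The functions `v_k`, on `ℂ ∖ [1, ∞)`. -/
noncomputable def v (k : ℕ) : ℂ → ℂ := principalBranch (vLocal k)

/-- The Gauss hypergeometric function `₂F₁(a, b; c; ·)` on `ℂ ∖ [1, ∞)`: the principal branch
of the hypergeometric series. -/
noncomputable def hyp (a b c : ℂ) : ℂ → ℂ :=
  principalBranch (fun t => ordinaryHypergeometric a b c t)

/-! ### The even meta-generating function -/

/-- The `k`-th term of the even meta-generating function. -/
noncomputable def VeTerm (t lam : ℂ) (k : ℕ) : ℂ :=
  v (2 * k + 2) t * (-1) ^ k * lam ^ (2 * k)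

/-- The even meta-generating function `V^e(t, λ) = ∑ v_{2k+2}(t) (-1)^k λ^{2k}`. -/
noncomputable def Ve (t lam : ℂ) : ℂ := ∑' k : ℕ, VeTerm t lam k

/-! ### The Laurent polynomials `P_l` and the torus integrals `u_l` -/

/-- The Laurent polynomials `P_l`, for `l = 2, 3, 4, 6` (and a placeholder for other `l`). -/
noncomputable def P (l : ℕ) (x y : ℂ) : ℂ :=
  match l with
  | 2 => x + 1 / x + y + 1 / y
  | 3 => x ^ 2 / y + y ^ 2 / x + 1 / (x * y)
  | 4 => x * y ^ 2 + x / y ^ 2 + 1 / x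
  | 6 => x ^ 2 / y - y / x - 1 / (x * y)
  | _ => 0

/-- The constants `C_2 = 2^4`, `C_3 = 3^3`, `C_4 = 2^6`, `C_6 = 2^4 3^3`
(and a placeholder for other `l`). -/
def C (l : ℕ) : ℂ :=
  match l with
  | 2 => 2 ^ 4
  | 3 => 3 ^ 3
  | 4 => 2 ^ 6
  | 6 => 2 ^ 4 * 3 ^ 3
  | _ => 0

/-- `u_l(λ) = (2πi)^{-2} ∫_{𝕋²} 1 / (1 - λ P_l(x, y)) dx/x dy/y`. -/
noncomputable def u (l : ℕ) (lam : ℂ) : ℂ :=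
  1 / (2 * Real.pi * Complex.I) ^ 2 *
    torusIntegral
      (fun z : Fin 2 → ℂ => 1 / (1 - lam * P l (z 0) (z 1)) * (1 / z 0) * (1 / z 1)) 0 1

/-- The set of `λ` for which `1 - λ P_l` has no zero on the torus. -/
def nonvanishing (l : ℕ) : Set ℂ :=
  {lam | ∀ x y : ℂ, ‖x‖ = 1 → ‖y‖ = 1 → 1 - lam * P l x y ≠ 0}

/-- The domain of `u_l`: the connected component of `0` in the set of `λ` for which
`1 - λ P_l` has no zero on the torus. -/
def torusDomain (l : ℕ) : Set ℂ := connectedComponentIn (nonvanishing l) 0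

end NcHO

/-! Everything reduces to integrals over the quadrant a, b > 0. Put a = -2 log(u₁⋯u_r) and b = -2
log(u_{r+1}⋯u_k). A product of r coordinates of the cube has density a^{r-1}/(r-1)! e^{-a/2} after
scaling by 2^r, so the binomial theorem collapses the sum over r, and J_{k+2}(n) is the integral of
(a+b)^k/k! · ω · (1-p)^n with ω = 1/(2 sinh((a+b)/2)) and p = sinh²((a-b)/2)/sinh²((a+b)/2)
(`J_eq`). For z = t/(t-1) one has (1-z)/(1-z(1-p)) = 1/(1-tp). Hence v_{k+2}(t) = ∫ (a+b)^k/k! ·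
ω/(1-tp), which is analytic off [1,∞) because 0 ≤ p ≤ 1 (`vLocal_eq`, `v_eq`). Summing over even k
turns the powers of a+b into cos(λ(a+b)); the decay ω ~ e^{-(a+b)/2} explains the condition |λ| <
1/2 (`hasSum_VeTerm`).

It remains to find the Taylor coefficients in t, the moments ∫ cos(λ(a+b)) ω pⁿ. With x = (a+b)/2
they become 2∫ cos(2λx) f_n(x) dx, where f_n(x) = sinh(x)^{-2n-1} ∫₀ˣ sinh^{2n}
(`integral_cosWeight_mul_ratio_pow`). The equation f_n'' = (2n+1)² f_n - (2n+2)² f_{n+1}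
(`hasDerivAt_sinhRatioDeriv`) and two integrations by parts give the hypergeometric recursion in n
(`cosMoment_succ`). The case n = 0 is ∫ cos(2λx) x/sinh x dx = π²/(4 cosh² πλ), from the partial
fractions of π²/sin² (`cosMoment_zero`).

For the torus integrals, the Taylor coefficients of u_l are the constant terms of P_lⁿ. They vanish
unless l divides n, and for n = lm they equal C_l^m (1/l)_m (1-1/l)_m / m!² (`torusMoment_eq`).
These are the hypergeometric coefficients at iλ = 1/2 - 1/l, so the two sides agree near 0. The
identity theorem carries this over D_l once C_l λ^l is known to avoid [1,∞). That holds because P_l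
takes on the torus every value ζr with ζ^l = 1 and 0 < r^l ≤ C_l (`exists_P_eq`,
`mul_pow_mem_cutPlane`). -/

namespace NcHO

open scoped ENNReal

/-! ### Cauchy-type integrals `∫ h / (1 - t g)` -/

section CauchyType

/-- Compactness of `K` makes the denominators bounded below uniformly near `t₀`. This serves both
the segment [0,1] containing the ratio and the range of a Laurent polynomial on the torus. -/
theorem exists_ball_le_norm_one_sub_mul {K : Set ℂ} (hK : IsCompact K) {t₀ : ℂ}
    (ht₀ : ∀ k ∈ K, 1 - t₀ * k ≠ 0) :
    ∃ ε > 0, ∃ c > 0, ∀ t ∈ Metric.ball t₀ ε, ∀ k ∈ K, c ≤ ‖1 - t * k‖ := by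
  rcases K.eq_empty_or_nonempty with rfl | hne
  · exact ⟨1, one_pos, 1, one_pos, by simp⟩
  obtain ⟨k₀, hk₀, hmin⟩ := hK.exists_isMinOn hne
    (f := fun k => ‖1 - t₀ * k‖) (by fun_prop)
  obtain ⟨M, hM⟩ := hK.isBounded.exists_norm_le
  have hM0 : 0 ≤ M := (norm_nonneg _).trans (hM k₀ hk₀)
  have hc : 0 < ‖1 - t₀ * k₀‖ := norm_pos_iff.2 (ht₀ k₀ hk₀)
  -- Half of the minimum survives if `(t - t₀) * k` costs at most the other half; `M + 1` avoids
  -- dividing by zero.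
  refine ⟨‖1 - t₀ * k₀‖ / (2 * (M + 1)), by positivity, ‖1 - t₀ * k₀‖ / 2, by positivity, ?_⟩
  intro t ht k hk
  have h1 : ‖1 - t₀ * k₀‖ ≤ ‖1 - t₀ * k‖ := hmin hk
  have h2 : ‖1 - t₀ * k‖ ≤ ‖1 - t * k‖ + ‖(t - t₀) * k‖ := by
    have : 1 - t₀ * k = (1 - t * k) + (t - t₀) * k := by ring
    rw [this]
    exact norm_add_le _ _
  have h3 : ‖(t - t₀) * k‖ ≤ ‖1 - t₀ * k₀‖ / 2 := by
    rw [norm_mul]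
    have h4 : ‖t - t₀‖ ≤ ‖1 - t₀ * k₀‖ / (2 * (M + 1)) := (mem_ball_iff_norm.1 ht).le
    calc ‖t - t₀‖ * ‖k‖ ≤ ‖1 - t₀ * k₀‖ / (2 * (M + 1)) * (M + 1) :=
          mul_le_mul h4 ((hM k hk).trans (by linarith)) (norm_nonneg _) (by positivity)
      _ = ‖1 - t₀ * k₀‖ / 2 := by field_simp
  linarith

theorem isOpen_setOf_one_sub_mul_ne_zero {K : Set ℂ} (hK : IsCompact K) :
    IsOpen {t : ℂ | ∀ k ∈ K, 1 - t * k ≠ 0} := by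
  rw [Metric.isOpen_iff]
  intro t₀ ht₀
  obtain ⟨ε, hε, c, hc, h⟩ := exists_ball_le_norm_one_sub_mul hK ht₀
  exact ⟨ε, hε, fun t ht k hk => norm_pos_iff.1 (hc.trans_le (h t ht k hk))⟩

variable {X : Type*} [MeasurableSpace X] {μ : Measure X} {h g : X → ℂ}

theorem integrable_div_one_sub_mul {K : Set ℂ} (hK : IsCompact K) (hh : Integrable h μ)
    (hg : AEStronglyMeasurable g μ) (hgK : ∀ᵐ x ∂μ, g x ∈ K) {t : ℂ}
    (ht : ∀ k ∈ K, 1 - t * k ≠ 0) : Integrable (fun x => h x / (1 - t * g x)) μ := by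
  obtain ⟨ε, hε, c, hc, hb⟩ := exists_ball_le_norm_one_sub_mul hK ht
  refine (hh.norm.div_const c).mono'
    (hh.aestronglyMeasurable.div₀ (by fun_prop)) ?_
  filter_upwards [hgK] with x hx
  rw [norm_div]
  exact div_le_div_of_nonneg_left (norm_nonneg _) hc (hb t (Metric.mem_ball_self hε) _ hx)

theorem differentiableOn_integral_div_one_sub_mul {K : Set ℂ} (hK : IsCompact K)
    (hh : Integrable h μ) (hg : AEStronglyMeasurable g μ) (hgK : ∀ᵐ x ∂μ, g x ∈ K) :
    DifferentiableOn ℂ (fun t => ∫ x, h x / (1 - t * g x) ∂μ)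
      {t : ℂ | ∀ k ∈ K, 1 - t * k ≠ 0} := by
  intro t₀ ht₀
  obtain ⟨ε, hε, c, hc, hb⟩ := exists_ball_le_norm_one_sub_mul hK ht₀
  obtain ⟨M, hM⟩ := hK.isBounded.exists_norm_le
  have hm : ∀ t : ℂ, AEStronglyMeasurable (fun x => h x / (1 - t * g x)) μ := fun t =>
    hh.aestronglyMeasurable.div₀ (by fun_prop)
  have key := hasDerivAt_integral_of_dominated_loc_of_deriv_le (𝕜 := ℂ) (μ := μ)
    (F := fun t x => h x / (1 - t * g x)) (F' := fun t x => h x * g x / (1 - t * g x) ^ 2)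
    (x₀ := t₀) (s := Metric.ball t₀ ε) (bound := fun x => ‖h x‖ * (M / c ^ 2))
    (Metric.ball_mem_nhds _ hε) (Eventually.of_forall hm)
    (integrable_div_one_sub_mul hK hh hg hgK ht₀)
    ((hh.aestronglyMeasurable.mul hg).div₀ (by fun_prop))
    (by
      filter_upwards [hgK] with x hx t ht
      rw [norm_div, norm_mul, norm_pow, mul_div_assoc]
      refine mul_le_mul_of_nonneg_left ?_ (norm_nonneg _)
      have := hb t ht _ hx
      have h0 : 0 ≤ M := (norm_nonneg _).trans (hM _ hx)
      exact div_le_div₀ h0 (hM _ hx) (by positivity) (pow_le_pow_left₀ hc.le this 2))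
    (hh.norm.mul_const _)
    (by
      filter_upwards [hgK] with x hx t ht
      have hne : 1 - t * g x ≠ 0 := norm_pos_iff.1 (hc.trans_le (hb t ht _ hx))
      have h1 : HasDerivAt (fun t : ℂ => 1 - t * g x) (-(g x)) t := by
        simpa using ((hasDerivAt_id t).mul_const (g x)).const_sub 1
      have h2 := (hasDerivAt_const t (h x)).div h1 hne
      exact h2.congr_deriv (by simp))
  exact key.2.differentiableAt.differentiableWithinAt

theorem hasSum_integral_mul_pow {R : ℝ} (hh : Integrable h μ) (hg : AEStronglyMeasurable g μ)
    (hgR : ∀ᵐ x ∂μ, ‖g x‖ ≤ R) {t : ℂ} (ht : ‖t‖ * R < 1) :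
    HasSum (fun n : ℕ => (∫ x, h x * g x ^ n ∂μ) * t ^ n) (∫ x, h x / (1 - t * g x) ∂μ) := by
  -- For the zero measure the bound on `g` is vacuous and `R` could be negative.
  rcases eq_or_ne μ 0 with rfl | hμ
  · simp [hasSum_zero]
  have hR : 0 ≤ R := by
    have : NeZero μ := ⟨hμ⟩
    obtain ⟨x, hx⟩ := hgR.exists
    exact (norm_nonneg _).trans hx
  have hr0 : 0 ≤ ‖t‖ * R := by positivity
  have key := hasSum_integral_of_dominated_convergence (μ := μ)
    (F := fun n x => h x * g x ^ n * t ^ n) (f := fun x => h x / (1 - t * g x))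
    (fun n x => ‖h x‖ * (‖t‖ * R) ^ n)
    (fun n => (hh.aestronglyMeasurable.mul (hg.pow n)).mul_const _)
    (fun n => by
      filter_upwards [hgR] with x hx
      rw [norm_mul, norm_mul, norm_pow, norm_pow, mul_assoc, ← mul_pow, mul_comm ‖g x‖]
      gcongr)
    (by
      filter_upwards with x
      exact (summable_geometric_of_lt_one hr0 ht).mul_left _)
    (by
      simp_rw [tsum_mul_left]
      exact hh.norm.mul_const _)
    (by
      filter_upwards [hgR] with x hx
      have : ‖t * g x‖ < 1 := by
        rw [norm_mul]
        exact lt_of_le_of_lt (mul_le_mul_of_nonneg_left hx (norm_nonneg _)) ht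
      have h1 := (hasSum_geometric_of_norm_lt_one this).mul_left (h x)
      rw [← div_eq_mul_inv] at h1
      have h2 : (fun n : ℕ => h x * g x ^ n * t ^ n) = fun n => h x * (t * g x) ^ n := by
        ext n
        rw [mul_pow]
        ring
      exact h2 ▸ h1)
  simpa only [integral_mul_const] using key

end CauchyType

/-! ### The open quadrant -/

/-- Lebesgue measure on the quadrant `(0, ∞) × (0, ∞)`. -/
noncomputable def quadrant : Measure (ℝ × ℝ) :=
  (volume.restrict (Ioi 0)).prod (volume.restrict (Ioi 0))

theorem quadrant_eq : quadrant = volume.restrict (Ioi 0 ×ˢ Ioi 0) := by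
  rw [quadrant, Measure.prod_restrict, Measure.volume_eq_prod]

instance : SigmaFinite quadrant := by
  unfold quadrant
  infer_instance

theorem ae_quadrant : ∀ᵐ x ∂quadrant, 0 < x.1 ∧ 0 < x.2 := by
  rw [quadrant_eq]
  filter_upwards [ae_restrict_mem (measurableSet_Ioi.prod measurableSet_Ioi)] with x hx
  exact hx

theorem measurableSet_sector : MeasurableSet {x : ℝ × ℝ | 0 < x.2 ∧ x.2 < x.1} :=
  (measurableSet_lt measurable_const measurable_snd).inter
    (measurableSet_lt measurable_snd measurable_fst)

/-- The shear has determinant 1. It introduces the coordinate s = a + b, on which the weight and the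
cosine depend alone. -/
theorem measurePreserving_quadrant :
    MeasurePreserving (fun x : ℝ × ℝ => (x.1 + x.2, x.2)) quadrant
      (volume.restrict {x : ℝ × ℝ | 0 < x.2 ∧ x.2 < x.1}) := by
  have h := (measurePreserving_add_prod (volume : Measure ℝ) (volume : Measure ℝ)).restrict_preimage
    measurableSet_sector
  have h2 : (fun x : ℝ × ℝ => (x.1 + x.2, x.2)) ⁻¹' {x : ℝ × ℝ | 0 < x.2 ∧ x.2 < x.1} =
      Ioi 0 ×ˢ Ioi 0 := by
    ext x
    simp [and_comm]
  rw [h2] at h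
  rwa [quadrant_eq]

theorem indicator_sector {β : Type*} [Zero β] (G : ℝ × ℝ → β) (s a : ℝ) :
    {x : ℝ × ℝ | 0 < x.2 ∧ x.2 < x.1}.indicator G (s, a) =
      (Ioi 0).indicator (fun s => (Ioo 0 s).indicator (fun a => G (s, a)) a) s := by
  by_cases h : 0 < a ∧ a < s
  · have hs : 0 < s := h.1.trans h.2
    simp [h, hs]
  · simp only [indicator, mem_ofPred_eq, mem_Ioo, mem_Ioi, h]
    simp

theorem lintegral_quadrant {G : ℝ × ℝ → ℝ≥0∞} (hG : Measurable G) :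
    ∫⁻ x, G (x.1 + x.2, x.2) ∂quadrant = ∫⁻ s in Ioi 0, ∫⁻ a in Ioo 0 s, G (s, a) := by
  rw [measurePreserving_quadrant.lintegral_comp hG, ← lintegral_indicator measurableSet_sector,
    Measure.volume_eq_prod,
    lintegral_prod _ (hG.indicator measurableSet_sector).aemeasurable,
    ← lintegral_indicator measurableSet_Ioi]
  congr 1 with s
  simp_rw [indicator_sector]
  by_cases hs : 0 < s
  · simp only [indicator_of_mem (mem_Ioi.2 hs)]
    rw [← lintegral_indicator measurableSet_Ioo]
  · simp [indicator, hs]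

theorem integral_quadrant {G : ℝ × ℝ → ℂ}
    (hG : Integrable (fun x => G (x.1 + x.2, x.2)) quadrant) (hm : Measurable G) :
    ∫ x, G (x.1 + x.2, x.2) ∂quadrant = ∫ s in Ioi 0, ∫ a in Ioo 0 s, G (s, a) := by
  have hi : IntegrableOn G {x : ℝ × ℝ | 0 < x.2 ∧ x.2 < x.1} :=
    (measurePreserving_quadrant.integrable_comp hm.aestronglyMeasurable).1 hG
  have h1 := integral_map (μ := quadrant) (f := G) measurePreserving_quadrant.measurable.aemeasurable
    hm.aestronglyMeasurable
  rw [measurePreserving_quadrant.map_eq] at h1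
  rw [← h1, ← integral_indicator measurableSet_sector, Measure.volume_eq_prod,
    integral_prod _ (by
      rw [← Measure.volume_eq_prod]
      exact (integrable_indicator_iff measurableSet_sector).2 hi),
    ← integral_indicator measurableSet_Ioi]
  congr 1 with s
  simp_rw [indicator_sector]
  by_cases hs : 0 < s
  · simp only [indicator_of_mem (mem_Ioi.2 hs)]
    rw [← integral_indicator measurableSet_Ioo]
  · simp [indicator, hs]

/-! ### Functions of a product of coordinates on the cube -/

/-- Substitution u = e^{-a/2}; the factor 2 cancels the 1/2 in the derivative. -/
theorem lintegral_Icc_eq_exp (f : ℝ → ℝ≥0∞) :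
    2 * ∫⁻ u in Icc 0 1, f u =
      ∫⁻ a in Ioi 0, ENNReal.ofReal (Real.exp (-a / 2)) * f (Real.exp (-a / 2)) := by
  have himg : (fun a : ℝ => Real.exp (-a / 2)) '' Ioi 0 = Ioo 0 1 := by
    ext u
    constructor
    · rintro ⟨a, ha, rfl⟩
      have ha : 0 < a := ha
      exact ⟨Real.exp_pos _, Real.exp_lt_one_iff.2 (by linarith)⟩
    · rintro ⟨h0, h1⟩
      refine ⟨-2 * Real.log u, ?_, ?_⟩
      · have := Real.log_neg h0 h1
        simp only [mem_Ioi]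
        linarith
      · simp only
        rw [show -(-2 * Real.log u) / 2 = Real.log u by ring, Real.exp_log h0]
  have hd : ∀ a ∈ Ioi (0 : ℝ), HasDerivWithinAt (fun a : ℝ => Real.exp (-a / 2))
      (Real.exp (-a / 2) * (-1 / 2)) (Ioi 0) a := fun a _ =>
    (((hasDerivAt_id a).neg.div_const 2).exp).hasDerivWithinAt
  have hinj : InjOn (fun a : ℝ => Real.exp (-a / 2)) (Ioi 0) := by
    intro a _ b _ hab
    have := Real.exp_injective hab
    linarith
  have h := lintegral_image_eq_lintegral_abs_deriv_mul measurableSet_Ioi hd hinj f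
  rw [himg] at h
  rw [Measure.restrict_congr_set (Ioo_ae_eq_Icc (α := ℝ) (μ := volume)).symm, h,
    ← lintegral_const_mul' _ _ (by simp)]
  congr 1 with a
  rw [← mul_assoc]
  congr 1
  rw [show (2 : ℝ≥0∞) = ENNReal.ofReal 2 by simp, ← ENNReal.ofReal_mul (by norm_num), abs_mul,
    abs_of_pos (Real.exp_pos _)]
  congr 1
  norm_num
  ring

theorem lintegral_Ioo_pow_div_factorial (r : ℕ) {s : ℝ} (hs : 0 ≤ s) :
    ∫⁻ a in Ioo 0 s, ENNReal.ofReal (a ^ r / r.factorial) =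
      ENNReal.ofReal (s ^ (r + 1) / (r + 1).factorial) := by
  rw [← ofReal_integral_eq_lintegral_ofReal]
  · rw [← integral_Ioc_eq_integral_Ioo, ← intervalIntegral.integral_of_le hs]
    congr 1
    rw [intervalIntegral.integral_div, integral_pow, Nat.factorial_succ]
    push_cast
    field_simp
    simp
  · refine IntegrableOn.mono_set (t := Icc 0 s) ?_ Ioo_subset_Icc_self
    exact (by fun_prop : Continuous fun a : ℝ => a ^ r / r.factorial).integrableOn_Icc
  · filter_upwards [ae_restrict_mem measurableSet_Ioo] with a ha
    have := ha.1
    simp only [Pi.zero_apply]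
    positivity

/-- The density, with respect to the coordinate `a = -2 log x`, of a product `x` of `r + 1`
independent uniform variables, up to the factor `2 ^ (r + 1)`. -/
noncomputable def cubeDensity (r : ℕ) (a : ℝ) : ℝ := Real.exp (-a / 2) * (a ^ r / r.factorial)

theorem measurable_cubeDensity (r : ℕ) : Measurable (cubeDensity r) := by
  unfold cubeDensity
  fun_prop

theorem cubeDensity_nonneg (r : ℕ) {a : ℝ} (ha : 0 ≤ a) : 0 ≤ cubeDensity r a := by
  unfold cubeDensity
  positivity

/-- The restriction of Lebesgue measure to `[0,1] ^ n`. -/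
noncomputable def cube (n : ℕ) : Measure (Fin n → ℝ) :=
  Measure.pi fun _ => volume.restrict (Icc 0 1)

instance (n : ℕ) : SigmaFinite (cube n) := by
  unfold cube
  infer_instance

theorem cube_eq (n : ℕ) : cube n = volume.restrict (Icc 0 1) := by
  have h : (Icc 0 1 : Set (Fin n → ℝ)) = univ.pi fun _ => Icc 0 1 := by
    rw [pi_univ_Icc]
    rfl
  rw [h, cube, volume_pi, Measure.restrict_pi_pi]

/-- Multiplying independent variables adds their logarithms, so each further coordinate convolves
the density with e^{-c/2}. The exponentials combine to e^{-s/2}, and the integral of a^r/r! over (0,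
s) raises the power by one. Lower integrals are used throughout so that no integrability is needed.
-/
theorem lintegral_cube_prod (r : ℕ) {f : ℝ → ℝ≥0∞} (hf : Measurable f) :
    2 ^ (r + 1) * ∫⁻ u, f (∏ i, u i) ∂(cube (r + 1)) =
      ∫⁻ a in Ioi 0, ENNReal.ofReal (cubeDensity r a) * f (Real.exp (-a / 2)) := by
  induction r generalizing f with
  | zero =>
    have h := (measurePreserving_funUnique (volume.restrict (Icc (0 : ℝ) 1)) (Fin 1)).lintegral_comp
      hf
    have h1 : ∫⁻ u, f (∏ i, u i) ∂(cube 1) = ∫⁻ b in Icc 0 1, f b := by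
      rw [← h]
      refine lintegral_congr fun u => ?_
      rw [Fin.prod_univ_one]
      rfl
    simp only [zero_add, pow_one, cubeDensity, pow_zero, Nat.factorial_zero,
      Nat.cast_one, div_one, mul_one]
    rw [← lintegral_Icc_eq_exp, h1]
  | succ r ih =>
    have h := (measurePreserving_piFinSuccAbove
      (fun _ : Fin (r + 2) => volume.restrict (Icc (0 : ℝ) 1)) 0).lintegral_comp
      (f := fun x : ℝ × (Fin (r + 1) → ℝ) => f (x.1 * ∏ i, x.2 i)) (by fun_prop)
    have h1 : ∫⁻ u, f (∏ i, u i) ∂(cube (r + 2)) =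
        ∫⁻ u in Icc 0 1, ∫⁻ y, f (u * ∏ i, y i) ∂(cube (r + 1)) := by
      rw [← lintegral_prod (fun x : ℝ × (Fin (r + 1) → ℝ) => f (x.1 * ∏ i, x.2 i)) (by fun_prop)]
      refine Eq.trans ?_ h
      refine lintegral_congr fun u => ?_
      rw [Fin.prod_univ_succ]
      rfl
    have h2 : ∀ u : ℝ, 2 ^ (r + 1) * ∫⁻ y, f (u * ∏ i, y i) ∂(cube (r + 1)) =
        ∫⁻ a in Ioi 0, ENNReal.ofReal (cubeDensity r a) * f (u * Real.exp (-a / 2)) := fun u =>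
      ih (f := fun x => f (u * x)) (by fun_prop)
    have hm := measurable_cubeDensity r
    rw [h1, pow_succ', mul_assoc, ← lintegral_const_mul' _ _ (by simp)]
    simp_rw [h2]
    rw [lintegral_Icc_eq_exp]
    have h3 : ∀ c : ℝ, ENNReal.ofReal (Real.exp (-c / 2)) *
        ∫⁻ a in Ioi 0, ENNReal.ofReal (cubeDensity r a) *
          f (Real.exp (-c / 2) * Real.exp (-a / 2)) =
        ∫⁻ a in Ioi 0, (fun x : ℝ × ℝ => ENNReal.ofReal (Real.exp (-x.1 / 2) *
          (x.2 ^ r / r.factorial)) * f (Real.exp (-x.1 / 2))) (c + a, a) := fun c => by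
      rw [← lintegral_const_mul' _ _ (by simp)]
      refine lintegral_congr fun a => ?_
      rw [← mul_assoc, ← ENNReal.ofReal_mul (Real.exp_pos _).le, cubeDensity, ← mul_assoc,
        ← Real.exp_add]
      simp only [← add_div, ← neg_add]
    simp_rw [h3]
    rw [← lintegral_prod (μ := volume.restrict (Ioi 0)) (ν := volume.restrict (Ioi 0))
      (fun x : ℝ × ℝ => (fun x : ℝ × ℝ => ENNReal.ofReal (Real.exp (-x.1 / 2) *
          (x.2 ^ r / r.factorial)) * f (Real.exp (-x.1 / 2))) (x.1 + x.2, x.2)) (by fun_prop)]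
    have h4 := lintegral_quadrant (G := fun x : ℝ × ℝ => ENNReal.ofReal (Real.exp (-x.1 / 2) *
          (x.2 ^ r / r.factorial)) * f (Real.exp (-x.1 / 2))) (by fun_prop)
    rw [quadrant] at h4
    rw [h4]
    refine setLIntegral_congr_fun measurableSet_Ioi fun s hs => ?_
    have hs : 0 < s := hs
    simp only
    rw [lintegral_mul_const _ (by fun_prop), cubeDensity, ENNReal.ofReal_mul (Real.exp_pos _).le,
      ← lintegral_Ioo_pow_div_factorial r hs.le, ← lintegral_const_mul' _ _ (by simp)]
    simp_rw [ENNReal.ofReal_mul (Real.exp_pos _).le]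

/-! ### The Apéry-like numbers as integrals over the quadrant -/

/-- The weight `1 / (2 sinh ((a + b) / 2))`. -/
noncomputable def weight (x : ℝ × ℝ) : ℝ := 1 / (2 * Real.sinh ((x.1 + x.2) / 2))

/-- The function `sinh² ((a - b) / 2) / sinh² ((a + b) / 2)`. -/
noncomputable def ratio (x : ℝ × ℝ) : ℝ :=
  (Real.sinh ((x.1 - x.2) / 2) / Real.sinh ((x.1 + x.2) / 2)) ^ 2

theorem measurable_weight : Measurable weight := by
  unfold weight
  have := Real.continuous_sinh.measurable
  fun_prop

theorem measurable_ratio : Measurable ratio := by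
  unfold ratio
  have := Real.continuous_sinh.measurable
  fun_prop

theorem weight_pos {x : ℝ × ℝ} (hx : 0 < x.1 ∧ 0 < x.2) : 0 < weight x := by
  have : 0 < Real.sinh ((x.1 + x.2) / 2) := Real.sinh_pos_iff.2 (by linarith)
  unfold weight
  positivity

theorem ratio_nonneg (x : ℝ × ℝ) : 0 ≤ ratio x := sq_nonneg _

theorem ratio_le_one {x : ℝ × ℝ} (hx : 0 < x.1 ∧ 0 < x.2) : ratio x ≤ 1 := by
  have h : 0 < Real.sinh ((x.1 + x.2) / 2) := Real.sinh_pos_iff.2 (by linarith)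
  unfold ratio
  rw [sq_le_one_iff_abs_le_one, abs_div, abs_of_pos h, div_le_one h, abs_le, ← Real.sinh_neg]
  exact ⟨Real.sinh_le_sinh.2 (by linarith), Real.sinh_le_sinh.2 (by linarith)⟩

/-- After multiplying out, this is (1 + s) e^{-s} ≤ 1. The left side is the weight integrated over
the segment a + b = s: the length s removes the singularity of 1/sinh at 0. -/
theorem div_two_mul_sinh_le {s : ℝ} (hs : 0 < s) :
    s / (2 * Real.sinh (s / 2)) ≤ (1 + s) * Real.exp (-s / 2) := by
  have h : 0 < Real.sinh (s / 2) := Real.sinh_pos_iff.2 (by linarith)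
  rw [div_le_iff₀ (by positivity)]
  have h1 : (1 + s) * Real.exp (-s / 2) * (2 * Real.sinh (s / 2)) =
      (1 + s) * (1 - Real.exp (-s)) := by
    rw [Real.sinh_eq]
    have h2 : Real.exp (-s / 2) * Real.exp (s / 2) = 1 := by
      rw [← Real.exp_add]
      simp [neg_div]
    have h3 : Real.exp (-s / 2) * Real.exp (-(s / 2)) = Real.exp (-s) := by
      rw [← Real.exp_add]
      congr 1
      ring
    linear_combination (1 + s) * h2 - (1 + s) * h3
  rw [h1]
  have h4 : (1 + s) * Real.exp (-s) ≤ 1 := by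
    rw [Real.exp_neg, ← div_eq_mul_inv, div_le_one (Real.exp_pos _)]
    linarith [Real.add_one_le_exp s]
  linarith

theorem exists_exp_mul_one_add_mul_exp_le {c : ℝ} (hc : c < 1 / 2) :
    ∃ e > 0, ∃ C : ℝ, ∀ s > 0,
      Real.exp (c * s) * ((1 + s) * Real.exp (-s / 2)) ≤ C * Real.exp (-e * s) := by
  -- Half of the gap 1/2 - c absorbs the factor 1 + s, the other half is the remaining decay rate.
  set e : ℝ := (1 / 2 - c) / 2 with he
  have he0 : 0 < e := by linarith
  refine ⟨e, he0, 1 + 1 / e, fun s hs => ?_⟩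
  have h1 : 1 + s ≤ (1 + 1 / e) * Real.exp (e * s) := by
    have h2 : 1 + e * s ≤ Real.exp (e * s) := by linarith [Real.add_one_le_exp (e * s)]
    have h3 : (1 + 1 / e) * (1 + e * s) = 1 + s + (1 / e + e * s) := by
      field_simp
      ring
    have h4 : 0 ≤ 1 / e + e * s := by positivity
    calc 1 + s ≤ (1 + 1 / e) * (1 + e * s) := by linarith
      _ ≤ _ := by gcongr
  calc Real.exp (c * s) * ((1 + s) * Real.exp (-s / 2))
      ≤ Real.exp (c * s) * ((1 + 1 / e) * Real.exp (e * s) * Real.exp (-s / 2)) := by gcongr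
    _ = (1 + 1 / e) * Real.exp (c * s + e * s + -s / 2) := by
      rw [Real.exp_add, Real.exp_add]
      ring
    _ = (1 + 1 / e) * Real.exp (-e * s) := by
      congr 2
      rw [he]
      ring

theorem integrableOn_exp_mul_one_add_mul_exp {c : ℝ} (hc : c < 1 / 2) :
    IntegrableOn (fun s => Real.exp (c * s) * ((1 + s) * Real.exp (-s / 2))) (Ioi 0) := by
  obtain ⟨e, he, C, hC⟩ := exists_exp_mul_one_add_mul_exp_le hc
  refine ((exp_neg_integrableOn_Ioi 0 he).const_mul C).mono' (by fun_prop) ?_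
  filter_upwards [ae_restrict_mem measurableSet_Ioi] with s hs
  have hs : 0 < s := hs
  rw [Real.norm_of_nonneg (by positivity)]
  exact hC s hs

/-- The source of the condition |λ| < 1/2: the growth e^{c(a+b)} must be beaten by the decay
e^{-(a+b)/2} of the weight. -/
theorem integrable_exp_mul_weight {c : ℝ} (hc : c < 1 / 2) :
    Integrable (fun x => Real.exp (c * (x.1 + x.2)) * weight x) quadrant := by
  have hmw := measurable_weight
  refine ⟨by fun_prop, ?_⟩
  rw [hasFiniteIntegral_iff_norm]
  have hms := Real.continuous_sinh.measurable
  have h1 := lintegral_quadrant (G := fun x : ℝ × ℝ => ENNReal.ofReal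
    ‖Real.exp (c * x.1) * (1 / (2 * Real.sinh (x.1 / 2)))‖) (by fun_prop)
  change ∫⁻ x, (fun x : ℝ × ℝ => ENNReal.ofReal
    ‖Real.exp (c * x.1) * (1 / (2 * Real.sinh (x.1 / 2)))‖) (x.1 + x.2, x.2) ∂quadrant < ⊤
  rw [h1]
  refine lt_of_le_of_lt ?_ (integrableOn_exp_mul_one_add_mul_exp hc).lintegral_lt_top
  refine setLIntegral_mono (by fun_prop) fun s hs => ?_
  have hs : 0 < s := hs
  have h : 0 < Real.sinh (s / 2) := Real.sinh_pos_iff.2 (by linarith)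
  change ∫⁻ _ in Ioo 0 s, ENNReal.ofReal ‖Real.exp (c * s) * (1 / (2 * Real.sinh (s / 2)))‖ ≤ _
  rw [setLIntegral_const, Real.volume_Ioo, sub_zero, ← ENNReal.ofReal_mul (norm_nonneg _),
    Real.norm_of_nonneg (by positivity)]
  refine ENNReal.ofReal_le_ofReal ?_
  rw [mul_assoc, one_div_mul_eq_div]
  gcongr
  exact div_two_mul_sinh_le hs

/-- The integrand of the Apéry-like numbers without the factor depending on `n`. -/
noncomputable def momentWeight (k : ℕ) (x : ℝ × ℝ) : ℝ :=
  (x.1 + x.2) ^ k / k.factorial * weight x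

theorem measurable_momentWeight (k : ℕ) : Measurable (momentWeight k) := by
  unfold momentWeight
  have := measurable_weight
  fun_prop

theorem momentWeight_nonneg (k : ℕ) {x : ℝ × ℝ} (hx : 0 < x.1 ∧ 0 < x.2) :
    0 ≤ momentWeight k x := by
  have := weight_pos hx
  have := hx.1
  have := hx.2
  unfold momentWeight
  positivity

theorem integrable_momentWeight (k : ℕ) : Integrable (momentWeight k) quadrant := by
  -- Any positive rate below 1/2 would do; s^k/k! ≤ 4^k e^{s/4}.
  refine ((integrable_exp_mul_weight (c := 1 / 4) (by norm_num)).const_mul (4 ^ k)).mono'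
    (measurable_momentWeight k).aestronglyMeasurable ?_
  filter_upwards [ae_quadrant] with x hx
  rw [Real.norm_of_nonneg (momentWeight_nonneg k hx), momentWeight, ← mul_assoc]
  refine mul_le_mul_of_nonneg_right ?_ (weight_pos hx).le
  have h := Real.pow_div_factorial_le_exp (1 / 4 * (x.1 + x.2)) (by linarith [hx.1, hx.2]) k
  calc (x.1 + x.2) ^ k / k.factorial
      = 4 ^ k * ((1 / 4 * (x.1 + x.2)) ^ k / k.factorial) := by
        rw [mul_pow, one_div, inv_pow]
        field_simp
    _ ≤ _ := by gcongr

/-- From sinh² X - sinh² Y = sinh(X+Y) sinh(X-Y) one gets 1 - p = sinh a · sinh b / sinh²((a+b)/2).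
In terms of A = e^{-a/2} and B = e^{-b/2} this is (1-A⁴)(1-B⁴)/(1-A²B²)². -/
theorem exp_mul_eq_weight_mul {a b : ℝ} (h : 0 < a ∧ 0 < b) (n : ℕ) :
    Real.exp (-a / 2) * Real.exp (-b / 2) * ((1 - Real.exp (-a / 2) ^ 4) ^ n *
      (1 - Real.exp (-b / 2) ^ 4) ^ n /
      (1 - Real.exp (-a / 2) ^ 2 * Real.exp (-b / 2) ^ 2) ^ (2 * n + 1)) =
    weight (a, b) * (1 - ratio (a, b)) ^ n := by
  have hw : weight (a, b) = 1 / (2 * Real.sinh ((a + b) / 2)) := rfl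
  have hp : ratio (a, b) = (Real.sinh ((a - b) / 2) / Real.sinh ((a + b) / 2)) ^ 2 := rfl
  have hA : Real.exp (a / 2) = (Real.exp (-a / 2))⁻¹ := by rw [neg_div, Real.exp_neg, inv_inv]
  have hB : Real.exp (b / 2) = (Real.exp (-b / 2))⁻¹ := by rw [neg_div, Real.exp_neg, inv_inv]
  have hs : Real.sinh ((a + b) / 2) = ((Real.exp (-a / 2))⁻¹ * (Real.exp (-b / 2))⁻¹ -
      Real.exp (-a / 2) * Real.exp (-b / 2)) / 2 := by
    rw [Real.sinh_eq, ← hA, ← hB, ← Real.exp_add, ← Real.exp_add]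
    ring_nf
  have hd : Real.sinh ((a - b) / 2) = ((Real.exp (-a / 2))⁻¹ * Real.exp (-b / 2) -
      Real.exp (-a / 2) * (Real.exp (-b / 2))⁻¹) / 2 := by
    rw [Real.sinh_eq, ← hA, ← hB, ← Real.exp_add, ← Real.exp_add]
    ring_nf
  have hA0 := Real.exp_pos (-a / 2)
  have hB0 := Real.exp_pos (-b / 2)
  have hA1 : Real.exp (-a / 2) < 1 := Real.exp_lt_one_iff.2 (by linarith [h.1])
  have hB1 : Real.exp (-b / 2) < 1 := Real.exp_lt_one_iff.2 (by linarith [h.2])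
  rw [hw, hp, hs, hd]
  generalize Real.exp (-a / 2) = A at *
  generalize Real.exp (-b / 2) = B at *
  have hAB : A * B < 1 := by nlinarith
  have hD : 1 - A ^ 2 * B ^ 2 ≠ 0 := by
    have : (A * B) ^ 2 < 1 := by
      have := mul_pos hA0 hB0
      nlinarith
    nlinarith
  have h1 : (A⁻¹ * B⁻¹ - A * B) / 2 = (1 - A ^ 2 * B ^ 2) / (2 * (A * B)) := by
    field_simp
  have h2 : (A⁻¹ * B - A * B⁻¹) / 2 = (B ^ 2 - A ^ 2) / (2 * (A * B)) := by
    field_simp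
  have h3 : 1 - ((B ^ 2 - A ^ 2) / (2 * (A * B)) / ((1 - A ^ 2 * B ^ 2) / (2 * (A * B)))) ^ 2 =
      (1 - A ^ 4) * (1 - B ^ 4) / (1 - A ^ 2 * B ^ 2) ^ 2 := by
    rw [div_div_div_cancel_right₀ (by positivity), div_pow, eq_div_iff (pow_ne_zero 2 hD),
      sub_mul, div_mul_cancel₀ _ (pow_ne_zero 2 hD)]
    ring
  have h4 : 1 / (2 * ((1 - A ^ 2 * B ^ 2) / (2 * (A * B)))) = A * B / (1 - A ^ 2 * B ^ 2) := by
    field_simp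
  rw [h1, h2, h3, h4, div_pow, mul_pow, ← pow_mul, pow_succ]
  field_simp
  ring

theorem lintegral_cube_prod_prod (r s : ℕ) {f : ℝ × ℝ → ℝ≥0∞} (hf : Measurable f) :
    2 ^ (r + 1 + (s + 1)) * ∫⁻ p, f (∏ i, p.1 i, ∏ j, p.2 j) ∂((cube (r + 1)).prod (cube (s + 1))) =
      ∫⁻ x, ENNReal.ofReal (cubeDensity r x.1 * cubeDensity s x.2) *
        f (Real.exp (-x.1 / 2), Real.exp (-x.2 / 2)) ∂quadrant := by
  have hr := measurable_cubeDensity r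
  have hs := measurable_cubeDensity s
  rw [quadrant, lintegral_prod _ (by fun_prop), lintegral_prod _ (by fun_prop), pow_add, mul_assoc,
    ← lintegral_const_mul' _ _ (by simp)]
  have h1 : ∀ u : Fin (r + 1) → ℝ,
      2 ^ (s + 1) * ∫⁻ y, f (∏ i, u i, ∏ j, y j) ∂(cube (s + 1)) =
      ∫⁻ b in Ioi 0, ENNReal.ofReal (cubeDensity s b) * f (∏ i, u i, Real.exp (-b / 2)) := fun u =>
    lintegral_cube_prod s (f := fun y => f (∏ i, u i, y)) (by fun_prop)
  simp_rw [h1]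
  rw [lintegral_cube_prod r (f := fun x => ∫⁻ b in Ioi 0, ENNReal.ofReal (cubeDensity s b) *
    f (x, Real.exp (-b / 2)))
    (Measurable.lintegral_prod_right' (f := fun z : ℝ × ℝ => ENNReal.ofReal (cubeDensity s z.2) *
      f (z.1, Real.exp (-z.2 / 2))) (by fun_prop))]
  refine setLIntegral_congr_fun measurableSet_Ioi fun a ha => ?_
  have ha : 0 < a := ha
  rw [← lintegral_const_mul' _ _ (by simp)]
  refine lintegral_congr fun b => ?_
  rw [ENNReal.ofReal_mul (cubeDensity_nonneg r ha.le), mul_assoc]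

theorem cubeIntegral_eq (r s n : ℕ) :
    cubeIntegral (r + 1) (s + 1) n = ∫ x, (x.1 ^ r / r.factorial) * (x.2 ^ s / s.factorial) *
      (weight x * (1 - ratio x) ^ n) ∂quadrant := by
  set f : ℝ × ℝ → ℝ := fun x => (1 - x.1 ^ 4) ^ n * (1 - x.2 ^ 4) ^ n /
    (1 - x.1 ^ 2 * x.2 ^ 2) ^ (2 * n + 1) with hf
  have hfm : Measurable f := by fun_prop
  have hf0 : ∀ x : ℝ × ℝ, 0 ≤ x.1 → x.1 ≤ 1 → 0 ≤ x.2 → x.2 ≤ 1 → 0 ≤ f x := by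
    intro x h1 h2 h3 h4
    have h5 : 0 ≤ 1 - x.1 ^ 4 := sub_nonneg.2 (pow_le_one₀ h1 h2)
    have h6 : 0 ≤ 1 - x.2 ^ 4 := sub_nonneg.2 (pow_le_one₀ h3 h4)
    have h7 : 0 ≤ 1 - x.1 ^ 2 * x.2 ^ 2 :=
      sub_nonneg.2 (mul_le_one₀ (pow_le_one₀ h1 h2) (by positivity) (pow_le_one₀ h3 h4))
    simp only [hf]
    positivity
  have hcube : (volume.restrict (Icc 0 1 : Set ((Fin (r + 1) → ℝ) × (Fin (s + 1) → ℝ)))) =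
      (cube (r + 1)).prod (cube (s + 1)) := by
    rw [cube_eq, cube_eq, Measure.prod_restrict, ← Measure.volume_eq_prod, Icc_prod_Icc]
    rfl
  have h1 : cubeIntegral (r + 1) (s + 1) n = 2 ^ (r + 1 + (s + 1)) *
      ∫ p, f (∏ i, p.1 i, ∏ j, p.2 j) ∂((cube (r + 1)).prod (cube (s + 1))) := by
    rw [cubeIntegral, hcube]
    simp only [hf, Finset.prod_pow]
  have hmem : ∀ᵐ p ∂((cube (r + 1)).prod (cube (s + 1))), 0 ≤ f (∏ i, p.1 i, ∏ j, p.2 j) := by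
    rw [← hcube]
    filter_upwards [ae_restrict_mem measurableSet_Icc] with p hp
    have h1 : ∏ i, p.1 i ≤ 1 := Finset.prod_le_one (fun i _ => hp.1.1 i) fun i _ => hp.2.1 i
    have h2 : ∏ i, p.2 i ≤ 1 := Finset.prod_le_one (fun i _ => hp.1.2 i) fun i _ => hp.2.2 i
    have h3 : 0 ≤ ∏ i, p.1 i := Finset.prod_nonneg fun i _ => hp.1.1 i
    have h4 : 0 ≤ ∏ i, p.2 i := Finset.prod_nonneg fun i _ => hp.1.2 i
    exact hf0 _ h3 h1 h4 h2
  have hw := measurable_weight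
  have hq := measurable_ratio
  rw [h1, integral_eq_lintegral_of_nonneg_ae hmem (hfm.comp (by fun_prop)).aestronglyMeasurable,
    integral_eq_lintegral_of_nonneg_ae _ (by fun_prop)]
  · have h2 := lintegral_cube_prod_prod r s (f := fun x => ENNReal.ofReal (f x)) (by fun_prop)
    have h3 : (2 : ℝ) ^ (r + 1 + (s + 1)) = ((2 : ℝ≥0∞) ^ (r + 1 + (s + 1))).toReal := by simp
    rw [h3, ← ENNReal.toReal_mul, h2]
    congr 1
    refine lintegral_congr_ae ?_
    filter_upwards [ae_quadrant] with x hx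
    rw [← ENNReal.ofReal_mul (mul_nonneg (cubeDensity_nonneg r hx.1.le)
      (cubeDensity_nonneg s hx.2.le)), ← exp_mul_eq_weight_mul hx]
    congr 1
    simp only [hf, cubeDensity]
    ring
  · filter_upwards [ae_quadrant] with x hx
    have h1 := hx.1.le
    have h2 := hx.2.le
    have h3 := (weight_pos hx).le
    have h4 : 0 ≤ 1 - ratio x := sub_nonneg.2 (ratio_le_one hx)
    simp only [Pi.zero_apply]
    positivity

theorem sum_pow_div_factorial_mul (a b : ℝ) (k : ℕ) :
    ∑ r ∈ Finset.range (k + 1), a ^ r / r.factorial * (b ^ (k - r) / (k - r).factorial) =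
      (a + b) ^ k / k.factorial := by
  rw [add_pow, Finset.sum_div]
  refine Finset.sum_congr rfl fun r hr => ?_
  rw [Nat.cast_choose ℝ (Nat.lt_succ_iff.1 (Finset.mem_range.1 hr))]
  field_simp

/-- The sum over the splittings of the k + 2 variables is the binomial expansion of (a + b)^k/k!. -/
theorem J_eq (k n : ℕ) : J (k + 2) n = ∫ x, momentWeight k x * (1 - ratio x) ^ n ∂quadrant := by
  have hw := measurable_weight
  have hq := measurable_ratio
  have h1 : J (k + 2) n = ∑ r ∈ Finset.range (k + 1), cubeIntegral (r + 1) (k - r + 1) n := by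
    rw [J, Finset.sum_Ico_eq_sum_range]
    refine Finset.sum_congr rfl fun r hr => ?_
    have := Finset.mem_range.1 hr
    rw [show k + 2 - (1 + r) = k - r + 1 by omega, add_comm 1 r]
  rw [h1]
  simp_rw [cubeIntegral_eq]
  rw [← integral_finsetSum]
  · refine integral_congr_ae (Eventually.of_forall fun x => ?_)
    simp only
    rw [← Finset.sum_mul, sum_pow_div_factorial_mul, momentWeight, mul_assoc]
  · intro r hr
    refine (integrable_momentWeight k).mono' (by fun_prop) ?_
    filter_upwards [ae_quadrant] with x hx
    have h1 := hx.1.le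
    have h2 := hx.2.le
    have h3 := (weight_pos hx).le
    have h4 : 0 ≤ 1 - ratio x := sub_nonneg.2 (ratio_le_one hx)
    have h5 : (1 - ratio x) ^ n ≤ 1 := pow_le_one₀ h4 (by linarith [ratio_nonneg x])
    rw [Real.norm_of_nonneg (by positivity), momentWeight, ← sum_pow_div_factorial_mul]
    refine mul_le_mul ?_ (mul_le_of_le_one_right h3 h5) (by positivity)
      (Finset.sum_nonneg fun i _ => by positivity)
    -- All terms of the binomial sum are nonnegative, so each is dominated by the whole.
    exact Finset.single_le_sum (f := fun r => x.1 ^ r / r.factorial *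
      (x.2 ^ (k - r) / (k - r).factorial)) (fun i _ => by positivity) hr

/-! ### The functions `v_k` on the cut plane -/

theorem isCompact_unitSegment : IsCompact ((fun r : ℝ => (r : ℂ)) '' Icc 0 1) :=
  isCompact_Icc.image Complex.continuous_ofReal

theorem one_sub_mul_ne_zero_of_mem_cutPlane {t : ℂ} (ht : t ∈ cutPlane) :
    ∀ k ∈ (fun r : ℝ => (r : ℂ)) '' Icc 0 1, 1 - t * k ≠ 0 := by
  rintro _ ⟨r, hr, rfl⟩ h
  have h1 : t * (r : ℂ) = 1 := (sub_eq_zero.1 h).symm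
  have hr0 : r ≠ 0 := by
    rintro rfl
    simp at h1
  have hr1 : 0 < r := lt_of_le_of_ne hr.1 hr0.symm
  have h2 : t = ((1 / r : ℝ) : ℂ) := by
    push_cast
    rw [eq_div_iff (by exact_mod_cast hr0), h1]
  refine ht ⟨?_, ?_⟩
  · rw [h2, Complex.ofReal_re, le_div_iff₀ hr1]
    linarith [hr.2]
  · rw [h2, Complex.ofReal_im]

theorem isOpen_cutPlane : IsOpen cutPlane := by
  have h : cutPlane = {t : ℂ | 1 ≤ t.re ∧ t.im = 0}ᶜ := rfl
  rw [h, isOpen_compl_iff]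
  exact (isClosed_le continuous_const Complex.continuous_re).inter
    (isClosed_eq Complex.continuous_im continuous_const)

theorem ratio_mem_unitSegment :
    ∀ᵐ x ∂quadrant, (ratio x : ℂ) ∈ (fun r : ℝ => (r : ℂ)) '' Icc 0 1 := by
  filter_upwards [ae_quadrant] with x hx
  exact ⟨ratio x, ⟨ratio_nonneg x, ratio_le_one hx⟩, rfl⟩

theorem aestronglyMeasurable_ratio :
    AEStronglyMeasurable (fun x => (ratio x : ℂ)) quadrant := by
  have := measurable_ratio
  fun_prop

/-- `∫ h / (1 - t p)` over the quadrant, where `p` is `ratio`. -/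
noncomputable def ratioIntegral (h : ℝ × ℝ → ℂ) (t : ℂ) : ℂ :=
  ∫ x, h x / (1 - t * (ratio x : ℂ)) ∂quadrant

theorem analyticOnNhd_ratioIntegral {h : ℝ × ℝ → ℂ} (hh : Integrable h quadrant) :
    AnalyticOnNhd ℂ (ratioIntegral h) cutPlane :=
  ((differentiableOn_integral_div_one_sub_mul isCompact_unitSegment hh aestronglyMeasurable_ratio
    ratio_mem_unitSegment).mono fun _ => one_sub_mul_ne_zero_of_mem_cutPlane).analyticOnNhd
    isOpen_cutPlane

theorem hasSum_ratioIntegral {h : ℝ × ℝ → ℂ} (hh : Integrable h quadrant) {t : ℂ}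
    (ht : ‖t‖ < 1) :
    HasSum (fun n : ℕ => (∫ x, h x * (ratio x : ℂ) ^ n ∂quadrant) * t ^ n) (ratioIntegral h t) := by
  refine hasSum_integral_mul_pow (R := 1) hh aestronglyMeasurable_ratio ?_ (by simpa using ht)
  filter_upwards [ae_quadrant] with x hx
  rw [Complex.norm_real, Real.norm_of_nonneg (ratio_nonneg x)]
  exact ratio_le_one hx

theorem hasSum_J (k : ℕ) {z : ℂ} (hz : ‖z‖ < 1) :
    HasSum (fun n : ℕ => (J (k + 2) n : ℂ) * z ^ n)
      (∫ x, (momentWeight k x : ℂ) / (1 - z * ((1 - ratio x : ℝ) : ℂ)) ∂quadrant) := by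
  have hm := measurable_ratio
  have h := hasSum_integral_mul_pow (R := 1) (μ := quadrant)
    (h := fun x => (momentWeight k x : ℂ)) (g := fun x => ((1 - ratio x : ℝ) : ℂ)) (t := z)
    (integrable_momentWeight k).ofReal (by fun_prop) (by
      filter_upwards [ae_quadrant] with x hx
      rw [Complex.norm_real, Real.norm_of_nonneg (sub_nonneg.2 (ratio_le_one hx))]
      linarith [ratio_nonneg x]) (by simpa using hz)
  convert h using 3 with n
  rw [J_eq, ← integral_complex_ofReal]
  push_cast
  rfl

/-- The condition |t| < |t - 1| says that t is closer to 0 than to 1. -/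
theorem norm_div_sub_one_lt_one {t : ℂ} (ht : t.re < 1 / 2) : ‖t / (t - 1)‖ < 1 := by
  have h1 : t - 1 ≠ 0 := by
    intro h
    have := congrArg Complex.re h
    simp at this
    linarith
  rw [norm_div, div_lt_one (norm_pos_iff.2 h1), ← sq_lt_sq₀ (norm_nonneg _) (norm_nonneg _),
    ← Complex.normSq_eq_norm_sq, ← Complex.normSq_eq_norm_sq, Complex.normSq_apply,
    Complex.normSq_apply]
  simp
  nlinarith

theorem mem_cutPlane_of_re_lt_one {t : ℂ} (ht : t.re < 1) : t ∈ cutPlane :=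
  fun h => absurd h.1 (not_le.2 ht)

/-- Under the integral, 1 - z = 1/(1-t) and 1 - z(1-p) = (1-tp)/(1-t), so the quotient is 1/(1-tp),
which no longer needs |z| < 1. -/
theorem vLocal_eq (k : ℕ) {t : ℂ} (ht : t.re < 1 / 2) :
    vLocal (k + 2) t = ratioIntegral (fun x => (momentWeight k x : ℂ)) t := by
  rw [vLocal, w, (hasSum_J k (norm_div_sub_one_lt_one ht)).tsum_eq, ← integral_const_mul,
    ratioIntegral]
  refine integral_congr_ae ?_
  filter_upwards [ratio_mem_unitSegment] with x hx
  have h1 : t - 1 ≠ 0 := by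
    intro h
    have := congrArg Complex.re h
    simp at this
    linarith
  have h2 := one_sub_mul_ne_zero_of_mem_cutPlane (mem_cutPlane_of_re_lt_one (by linarith)) _ hx
  have h0 : 1 - t ≠ 0 := by
    rw [← neg_sub]
    exact neg_ne_zero.2 h1
  have h3 : 1 - t / (t - 1) * ((1 - ratio x : ℝ) : ℂ) = (1 - t * (ratio x : ℂ)) * (1 - t)⁻¹ := by
    rw [← neg_sub 1 t]
    push_cast
    field_simp
    ring
  have h4 : 1 - t / (t - 1) = (1 - t)⁻¹ := by
    rw [← neg_sub 1 t]
    field_simp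
    ring
  rw [h3, h4]
  field_simp

theorem eventually_re_lt_half : ∀ᶠ t : ℂ in 𝓝 0, t.re < 1 / 2 :=
  (isOpen_lt Complex.continuous_re continuous_const).mem_nhds (by simp)

theorem isContinuation_vLocal (k : ℕ) :
    IsContinuation (vLocal (k + 2)) (ratioIntegral fun x => (momentWeight k x : ℂ)) := by
  refine ⟨analyticOnNhd_ratioIntegral (integrable_momentWeight k).ofReal, ?_⟩
  filter_upwards [eventually_re_lt_half] with t ht
  exact (vLocal_eq k ht).symm

theorem v_eq (k : ℕ) {t : ℂ} (ht : t ∈ cutPlane) :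
    v (k + 2) t = ratioIntegral (fun x => (momentWeight k x : ℂ)) t :=
  principalBranch_eq (isContinuation_vLocal k) ht

theorem analyticOnNhd_v (k : ℕ) : AnalyticOnNhd ℂ (v (k + 2)) cutPlane :=
  (isContinuation_vLocal k).1.congr isOpen_cutPlane fun _ ht => (v_eq k ht).symm

/-! ### The even meta-generating function as an integral -/

/-- `cos (λ (a + b))` times the weight. -/
noncomputable def cosWeight (lam : ℂ) (x : ℝ × ℝ) : ℂ :=
  Complex.cos (lam * ((x.1 + x.2 : ℝ) : ℂ)) * (weight x : ℂ)

theorem norm_cos_le_exp (z : ℂ) : ‖Complex.cos z‖ ≤ Real.exp ‖z‖ := by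
  have h1 : ‖Complex.exp (z * Complex.I)‖ ≤ Real.exp ‖z‖ := by
    simpa using Complex.norm_exp_le_exp_norm (z * Complex.I)
  have h2 : ‖Complex.exp (-z * Complex.I)‖ ≤ Real.exp ‖z‖ := by
    simpa using Complex.norm_exp_le_exp_norm (-z * Complex.I)
  rw [Complex.cos, norm_div, Complex.norm_two, div_le_iff₀ two_pos]
  linarith [norm_add_le (Complex.exp (z * Complex.I)) (Complex.exp (-z * Complex.I))]

theorem norm_sin_le_exp (z : ℂ) : ‖Complex.sin z‖ ≤ Real.exp ‖z‖ := by
  have h1 : ‖Complex.exp (z * Complex.I)‖ ≤ Real.exp ‖z‖ := by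
    simpa using Complex.norm_exp_le_exp_norm (z * Complex.I)
  have h2 : ‖Complex.exp (-z * Complex.I)‖ ≤ Real.exp ‖z‖ := by
    simpa using Complex.norm_exp_le_exp_norm (-z * Complex.I)
  rw [Complex.sin, norm_div, Complex.norm_two, div_le_iff₀ two_pos, norm_mul, Complex.norm_I,
    mul_one]
  linarith [norm_sub_le (Complex.exp (-z * Complex.I)) (Complex.exp (z * Complex.I))]

theorem measurable_cosWeight (lam : ℂ) : Measurable (cosWeight lam) := by
  have h1 := measurable_weight
  have h2 := Complex.continuous_cos.measurable
  unfold cosWeight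
  fun_prop

theorem norm_cosWeight_le (lam : ℂ) {x : ℝ × ℝ} (hx : 0 < x.1 ∧ 0 < x.2) :
    ‖cosWeight lam x‖ ≤ Real.exp (‖lam‖ * (x.1 + x.2)) * weight x := by
  rw [cosWeight, norm_mul, Complex.norm_real, Real.norm_of_nonneg (weight_pos hx).le]
  refine mul_le_mul_of_nonneg_right ?_ (weight_pos hx).le
  refine (norm_cos_le_exp _).trans_eq ?_
  rw [norm_mul, Complex.norm_real, Real.norm_of_nonneg (by linarith [hx.1, hx.2])]

theorem integrable_cosWeight {lam : ℂ} (hl : ‖lam‖ < 1 / 2) :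
    Integrable (cosWeight lam) quadrant := by
  refine (integrable_exp_mul_weight hl).mono' (measurable_cosWeight lam).aestronglyMeasurable ?_
  filter_upwards [ae_quadrant] with x hx
  exact norm_cosWeight_le lam hx

/-- Sum and integral are exchanged by dominated convergence: the cosine series gives `cosWeight`,
and the absolute values sum to the hyperbolic cosine series of ‖λ‖(a+b), integrable against the
weight. -/
theorem hasSum_VeTerm {t lam : ℂ} (ht : t ∈ cutPlane) (hl : ‖lam‖ < 1 / 2) :
    HasSum (VeTerm t lam) (ratioIntegral (cosWeight lam) t) := by
  have hmr := measurable_ratio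
  obtain ⟨ε, hε, c, hc, hb⟩ := exists_ball_le_norm_one_sub_mul isCompact_unitSegment
    (one_sub_mul_ne_zero_of_mem_cutPlane ht)
  have hterm : ∀ k : ℕ, VeTerm t lam k = ∫ x, (momentWeight (2 * k) x : ℂ) *
      ((-1) ^ k * lam ^ (2 * k)) / (1 - t * (ratio x : ℂ)) ∂quadrant := by
    intro k
    rw [VeTerm, v_eq _ ht, ratioIntegral, mul_assoc, ← integral_mul_const]
    congr 1 with x
    ring
  simp_rw [funext hterm, ratioIntegral]
  have hexp : ∀ x : ℝ × ℝ, HasSum (fun k : ℕ => ((‖lam‖ * (x.1 + x.2)) ^ (2 * k) /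
      (2 * k).factorial) * weight x / c)
      (Real.cosh (‖lam‖ * (x.1 + x.2)) * weight x / c) := fun x =>
    ((Real.hasSum_cosh _).mul_right _).div_const _
  refine hasSum_integral_of_dominated_convergence
    (fun k x => ((‖lam‖ * (x.1 + x.2)) ^ (2 * k) / (2 * k).factorial) * weight x / c)
    (fun k => ?_) (fun k => ?_) (Eventually.of_forall fun x => (hexp x).summable) ?_ ?_
  · have := measurable_momentWeight (2 * k)
    exact Measurable.aestronglyMeasurable (by fun_prop)
  · filter_upwards [ae_quadrant, ratio_mem_unitSegment] with x hx hx2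
    have h1 := hb t (Metric.mem_ball_self hε) _ hx2
    rw [norm_div, norm_mul, norm_mul, norm_pow, norm_pow, norm_neg, norm_one, one_pow, one_mul,
      Complex.norm_real, Real.norm_of_nonneg (momentWeight_nonneg _ hx)]
    have h2 : momentWeight (2 * k) x * ‖lam‖ ^ (2 * k) =
        ((‖lam‖ * (x.1 + x.2)) ^ (2 * k) / (2 * k).factorial) * weight x := by
      rw [momentWeight, mul_pow]
      ring
    rw [← h2]
    have := momentWeight_nonneg (2 * k) hx
    exact div_le_div_of_nonneg_left (by positivity) hc h1
  · simp_rw [fun x => (hexp x).tsum_eq]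
    refine Integrable.div_const ?_ c
    have hw := measurable_weight
    have hco := Real.continuous_cosh.measurable
    refine (integrable_exp_mul_weight hl).mono' (by fun_prop) ?_
    filter_upwards [ae_quadrant] with x hx
    have := Real.cosh_pos (‖lam‖ * (x.1 + x.2))
    rw [Real.norm_of_nonneg (mul_nonneg this.le (weight_pos hx).le)]
    refine mul_le_mul_of_nonneg_right ?_ (weight_pos hx).le
    rw [Real.cosh_eq]
    have h1 : 0 ≤ ‖lam‖ * (x.1 + x.2) := mul_nonneg (norm_nonneg _) (by linarith [hx.1, hx.2])
    have h2 : Real.exp (-(‖lam‖ * (x.1 + x.2))) ≤ Real.exp (‖lam‖ * (x.1 + x.2)) :=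
      Real.exp_le_exp.2 (by linarith)
    linarith
  · refine Eventually.of_forall fun x => ?_
    have h1 := ((Complex.hasSum_cos (lam * ((x.1 + x.2 : ℝ) : ℂ))).mul_right
      (weight x : ℂ)).div_const (1 - t * (ratio x : ℂ))
    rw [cosWeight]
    have h2 : (fun k : ℕ => (momentWeight (2 * k) x : ℂ) * ((-1) ^ k * lam ^ (2 * k)) /
        (1 - t * (ratio x : ℂ))) = fun k : ℕ => (-1) ^ k * (lam * ((x.1 + x.2 : ℝ) : ℂ)) ^ (2 * k) /
        ((2 * k).factorial : ℂ) * (weight x : ℂ) / (1 - t * (ratio x : ℂ)) := by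
      ext k
      rw [momentWeight, mul_pow]
      push_cast
      ring
    rw [h2]
    exact h1

/-! ### The moments of the ratio -/

/-- `∫₀ˣ sinh ^ (2n)`. -/
noncomputable def sinhIntegral (n : ℕ) (x : ℝ) : ℝ := ∫ y in (0 : ℝ)..x, Real.sinh y ^ (2 * n)

theorem hasDerivAt_sinhIntegral (n : ℕ) (x : ℝ) :
    HasDerivAt (sinhIntegral n) (Real.sinh x ^ (2 * n)) x := by
  have hc : Continuous fun y => Real.sinh y ^ (2 * n) := Real.continuous_sinh.pow _
  exact (hc.integral_hasStrictDerivAt 0 x).hasDerivAt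

theorem sinhIntegral_zero_right (n : ℕ) : sinhIntegral n 0 = 0 := intervalIntegral.integral_same

theorem eq_zero_of_hasDerivAt_zero {F : ℝ → ℝ} (h : ∀ x, HasDerivAt F 0 x) (h0 : F 0 = 0) (x : ℝ) :
    F x = 0 := by
  rw [← h0]
  exact is_const_of_deriv_eq_zero (fun x => (h x).differentiableAt) (fun x => (h x).deriv) x 0

/-- The reduction formula for powers of sinh; both sides vanish at 0 and have the same derivative.
-/
theorem sinhIntegral_succ (n : ℕ) (x : ℝ) :
    (2 * n + 2) * sinhIntegral (n + 1) x =
      Real.sinh x ^ (2 * n + 1) * Real.cosh x - (2 * n + 1) * sinhIntegral n x := by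
  refine sub_eq_zero.1 (eq_zero_of_hasDerivAt_zero
    (F := fun x => (2 * n + 2) * sinhIntegral (n + 1) x -
      (Real.sinh x ^ (2 * n + 1) * Real.cosh x - (2 * n + 1) * sinhIntegral n x))
    (fun x => ?_) (by simp [sinhIntegral_zero_right]) x)
  have h := ((hasDerivAt_sinhIntegral (n + 1) x).const_mul (2 * (n : ℝ) + 2)).sub
    ((((Real.hasDerivAt_sinh x).pow (2 * n + 1)).mul (Real.hasDerivAt_cosh x)).sub
      ((hasDerivAt_sinhIntegral n x).const_mul (2 * (n : ℝ) + 1)))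
  refine h.congr_deriv ?_
  have h1 := Real.cosh_sq x
  push_cast
  simp only [Pi.pow_apply, mul_add, mul_one, pow_add, pow_one]
  linear_combination -(2 * (n : ℝ) + 1) * Real.sinh x ^ (2 * n) * h1

theorem sinhIntegral_nonneg (n : ℕ) {x : ℝ} (hx : 0 ≤ x) : 0 ≤ sinhIntegral n x :=
  intervalIntegral.integral_nonneg hx fun y _ => by
    rw [pow_mul]
    positivity

theorem sinhIntegral_le (n : ℕ) {x : ℝ} (hx : 0 ≤ x) :
    sinhIntegral n x ≤ x * Real.sinh x ^ (2 * n) := by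
  have hc : Continuous fun y => Real.sinh y ^ (2 * n) := Real.continuous_sinh.pow _
  have h := intervalIntegral.integral_mono_on (μ := volume) hx (hc.intervalIntegrable 0 x)
    (g := fun _ => Real.sinh x ^ (2 * n)) (continuous_const.intervalIntegrable 0 x)
    fun y hy => pow_le_pow_left₀ (Real.sinh_nonneg_iff.2 hy.1) (Real.sinh_le_sinh.2 hy.2) _
  simpa [sinhIntegral] using h

/-- Write sinh(x)^{2n+1} as (2n+1) ∫₀ˣ sinh^{2n} cosh and use 1 ≤ cosh y ≤ cosh x. This captures the
cancellation in the numerator of `sinhRatioDeriv` near 0. -/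
theorem abs_sinh_pow_sub_le (n : ℕ) {x : ℝ} (hx : 0 ≤ x) :
    |Real.sinh x ^ (2 * n + 1) - (2 * n + 1) * Real.cosh x * sinhIntegral n x| ≤
      (2 * n + 1) * (Real.cosh x - 1) * sinhIntegral n x := by
  have hc : Continuous fun y => Real.sinh y ^ (2 * n) := Real.continuous_sinh.pow _
  have hc2 : Continuous fun y => Real.sinh y ^ (2 * n) * Real.cosh y :=
    hc.mul Real.continuous_cosh
  have h1 : (2 * n + 1) * ∫ y in (0 : ℝ)..x, Real.sinh y ^ (2 * n) * Real.cosh y =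
      Real.sinh x ^ (2 * n + 1) := by
    rw [← intervalIntegral.integral_const_mul, intervalIntegral.integral_eq_sub_of_hasDerivAt
      (f := fun y => Real.sinh y ^ (2 * n + 1))]
    · simp
    · intro y _
      refine ((Real.hasDerivAt_sinh y).pow (2 * n + 1)).congr_deriv ?_
      push_cast
      ring
    · exact (hc2.const_mul _).intervalIntegrable _ _
  have h2 : sinhIntegral n x ≤ ∫ y in (0 : ℝ)..x, Real.sinh y ^ (2 * n) * Real.cosh y := by
    refine intervalIntegral.integral_mono_on hx (hc.intervalIntegrable 0 x)
      (hc2.intervalIntegrable 0 x) fun y hy => ?_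
    refine le_mul_of_one_le_right ?_ (Real.one_le_cosh y)
    rw [pow_mul]
    positivity
  have h3 : ∫ y in (0 : ℝ)..x, Real.sinh y ^ (2 * n) * Real.cosh y ≤
      sinhIntegral n x * Real.cosh x := by
    rw [sinhIntegral, ← intervalIntegral.integral_mul_const]
    refine intervalIntegral.integral_mono_on hx (hc2.intervalIntegrable 0 x)
      ((hc.mul_const _).intervalIntegrable 0 x) fun y hy => ?_
    refine mul_le_mul_of_nonneg_left ?_ ?_
    · rw [Real.cosh_le_cosh, abs_of_nonneg hy.1, abs_of_nonneg hx]
      exact hy.2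
    · rw [pow_mul]
      positivity
  rw [← h1, abs_le]
  have hn : (0 : ℝ) ≤ 2 * n + 1 := by positivity
  have h4 := mul_le_mul_of_nonneg_left h2 hn
  have h5 := mul_le_mul_of_nonneg_left h3 hn
  have h6 := mul_nonneg (mul_nonneg hn (sub_nonneg.2 (Real.one_le_cosh x)))
    (sinhIntegral_nonneg n hx)
  constructor <;> nlinarith

/-- The functions `sinh x ^ (-2n-1) ∫₀ˣ sinh ^ (2n)`. -/
noncomputable def sinhRatio (n : ℕ) (x : ℝ) : ℝ := sinhIntegral n x / Real.sinh x ^ (2 * n + 1)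

/-- The derivative of `sinhRatio n`. -/
noncomputable def sinhRatioDeriv (n : ℕ) (x : ℝ) : ℝ :=
  (1 - (2 * n + 1) * Real.cosh x * sinhRatio n x) / Real.sinh x

theorem sinhRatio_zero_left (x : ℝ) : sinhRatio 0 x = x / Real.sinh x := by
  simp [sinhRatio, sinhIntegral]

theorem sinhRatio_nonneg (n : ℕ) {x : ℝ} (hx : 0 < x) : 0 ≤ sinhRatio n x := by
  have := sinhIntegral_nonneg n hx.le
  have := Real.sinh_pos_iff.2 hx
  unfold sinhRatio
  positivity

theorem sinhRatio_le (n : ℕ) {x : ℝ} (hx : 0 < x) : sinhRatio n x ≤ x / Real.sinh x := by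
  have h := Real.sinh_pos_iff.2 hx
  rw [sinhRatio, div_le_div_iff₀ (by positivity) h, pow_succ, ← mul_assoc]
  exact mul_le_mul_of_nonneg_right (sinhIntegral_le n hx.le) h.le

theorem sinhRatio_le_one (n : ℕ) {x : ℝ} (hx : 0 < x) : sinhRatio n x ≤ 1 := by
  refine (sinhRatio_le n hx).trans ?_
  rw [div_le_one (Real.sinh_pos_iff.2 hx)]
  exact (Real.self_le_sinh_iff).2 hx.le

theorem sinhRatio_le_exp (n : ℕ) {x : ℝ} (hx : 0 < x) :
    sinhRatio n x ≤ (1 + 2 * x) * Real.exp (-(2 * x) / 2) := by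
  refine (sinhRatio_le n hx).trans ?_
  have h := div_two_mul_sinh_le (s := 2 * x) (by linarith)
  rwa [mul_div_mul_left _ _ two_ne_zero, mul_div_cancel_left₀ _ two_ne_zero] at h

/-- The factor cosh x - 1 from the numerator cancels against sinh² x = (cosh x - 1)(cosh x + 1). The
bound is then good both at 0, where it vanishes linearly, and at infinity, where it decays
exponentially. -/
theorem abs_sinhRatioDeriv_le (n : ℕ) {x : ℝ} (hx : 0 < x) :
    |sinhRatioDeriv n x| ≤ (2 * n + 1) * (x / (Real.cosh x + 1)) := by
  have h := Real.sinh_pos_iff.2 hx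
  have h1 := abs_sinh_pow_sub_le n hx.le
  have h2 := Real.one_le_cosh x
  have h3 : sinhRatioDeriv n x =
      (Real.sinh x ^ (2 * n + 1) - (2 * n + 1) * Real.cosh x * sinhIntegral n x) /
        (Real.sinh x ^ (2 * n) * Real.sinh x ^ 2) := by
    rw [sinhRatioDeriv, sinhRatio, ← pow_add, pow_succ _ (2 * n + 1)]
    field_simp
  rw [h3, abs_div, abs_of_pos (a := Real.sinh x ^ (2 * n) * Real.sinh x ^ 2) (by positivity),
    div_le_iff₀ (by positivity)]
  refine h1.trans ?_
  have h4 : Real.sinh x ^ 2 = (Real.cosh x - 1) * (Real.cosh x + 1) := by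
    rw [Real.sinh_sq]
    ring
  rw [h4]
  have h5 : (2 * n + 1) * (x / (Real.cosh x + 1)) *
      (Real.sinh x ^ (2 * n) * ((Real.cosh x - 1) * (Real.cosh x + 1))) =
      (2 * n + 1) * (Real.cosh x - 1) * (x * Real.sinh x ^ (2 * n)) := by
    field_simp
  rw [h5]
  exact mul_le_mul_of_nonneg_left (sinhIntegral_le n hx.le)
    (mul_nonneg (by positivity) (by linarith))

theorem abs_sinhRatioDeriv_le_self (n : ℕ) {x : ℝ} (hx : 0 < x) :
    |sinhRatioDeriv n x| ≤ (2 * n + 1) * x := by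
  refine (abs_sinhRatioDeriv_le n hx).trans ?_
  gcongr
  exact div_le_self hx.le (by linarith [Real.cosh_pos x])

theorem abs_sinhRatioDeriv_le_exp (n : ℕ) {x : ℝ} (hx : 0 < x) :
    |sinhRatioDeriv n x| ≤ (2 * n + 1) * ((1 + 2 * x) * Real.exp (-(2 * x) / 2)) := by
  refine (abs_sinhRatioDeriv_le n hx).trans ?_
  gcongr
  have h1 : Real.exp x / 2 ≤ Real.cosh x + 1 := by
    rw [Real.cosh_eq]
    linarith [Real.exp_pos (-x)]
  rw [div_le_iff₀ (by linarith [Real.cosh_pos x])]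
  have h2 : Real.exp (-(2 * x) / 2) * Real.exp x = 1 := by
    rw [← Real.exp_add]
    ring_nf
    exact Real.exp_zero
  have h3 := Real.exp_pos (-(2 * x) / 2)
  calc x ≤ (1 + 2 * x) * (1 / 2) := by linarith
    _ = (1 + 2 * x) * Real.exp (-(2 * x) / 2) * (Real.exp x / 2) := by
      linear_combination (-(1 + 2 * x) / 2) * h2
    _ ≤ _ := by gcongr

theorem hasDerivAt_sinhRatio (n : ℕ) {x : ℝ} (hx : 0 < x) :
    HasDerivAt (sinhRatio n) (sinhRatioDeriv n x) x := by
  have h := Real.sinh_pos_iff.2 hx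
  refine ((hasDerivAt_sinhIntegral n x).div ((Real.hasDerivAt_sinh x).pow (2 * n + 1))
    (pow_ne_zero _ h.ne')).congr_deriv ?_
  rw [sinhRatioDeriv, sinhRatio]
  push_cast
  simp only [Pi.pow_apply, pow_succ]
  field_simp

theorem sinhRatio_succ (n : ℕ) {x : ℝ} (hx : 0 < x) :
    (2 * n + 2) * sinhRatio (n + 1) x =
      (Real.cosh x - (2 * n + 1) * sinhRatio n x) / Real.sinh x ^ 2 := by
  have h := Real.sinh_pos_iff.2 hx
  rw [sinhRatio, ← mul_div_assoc, sinhIntegral_succ, sinhRatio,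
    show 2 * (n + 1) + 1 = 2 * n + 1 + 2 by ring, pow_add]
  field_simp
  ring

/-- The differential equation linking consecutive n. It becomes the recursion for the moments, with
the reduction formula supplying the term in n + 1. -/
theorem hasDerivAt_sinhRatioDeriv (n : ℕ) {x : ℝ} (hx : 0 < x) :
    HasDerivAt (sinhRatioDeriv n)
      ((2 * n + 1) ^ 2 * sinhRatio n x - (2 * n + 2) ^ 2 * sinhRatio (n + 1) x) x := by
  have h := Real.sinh_pos_iff.2 hx
  have h1 := ((((Real.hasDerivAt_cosh x).const_mul (2 * (n : ℝ) + 1)).mul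
    (hasDerivAt_sinhRatio n hx)).const_sub 1).div (Real.hasDerivAt_sinh x) h.ne'
  refine h1.congr_deriv ?_
  rw [show (2 * (n : ℝ) + 2) ^ 2 * sinhRatio (n + 1) x =
    (2 * n + 2) * ((2 * n + 2) * sinhRatio (n + 1) x) by ring, sinhRatio_succ n hx, sinhRatioDeriv]
  have h2 := Real.cosh_sq x
  simp only [Pi.mul_apply]
  field_simp
  linear_combination (2 * (n : ℝ) + 1) * (2 * n + 2) * sinhRatio n x * h2

/-! ### Fourier integrals of `sinhRatio` -/

theorem measurable_sinhRatio (n : ℕ) : Measurable (sinhRatio n) := by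
  have h1 : Measurable (sinhIntegral n) := (continuous_iff_continuousAt.2 fun x =>
    (hasDerivAt_sinhIntegral n x).continuousAt).measurable
  have h2 := Real.continuous_sinh.measurable
  unfold sinhRatio
  fun_prop

/-- `∫₀^∞ cos (2 λ x) sinhRatio n x dx`. -/
noncomputable def cosMoment (n : ℕ) (lam : ℂ) : ℂ :=
  ∫ x in Ioi (0 : ℝ), Complex.cos (2 * lam * x) * (sinhRatio n x : ℂ)

theorem norm_two_mul_mul (lam : ℂ) {x : ℝ} (hx : 0 < x) :
    ‖2 * lam * (x : ℂ)‖ = ‖lam‖ * (2 * x) := by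
  rw [norm_mul, norm_mul, Complex.norm_two, Complex.norm_real, Real.norm_of_nonneg hx.le]
  ring

theorem integrableOn_majorant {c : ℝ} (hc : c < 1 / 2) :
    IntegrableOn (fun x => Real.exp (c * (2 * x)) *
      ((1 + 2 * x) * Real.exp (-(2 * x) / 2))) (Ioi 0) := by
  have h := integrableOn_exp_mul_one_add_mul_exp hc
  have := (integrableOn_Ioi_comp_mul_left_iff
    (fun s => Real.exp (c * s) * ((1 + s) * Real.exp (-s / 2))) 0 (two_pos)).2 (by simpa using h)
  exact this

theorem norm_cos_mul_sinhRatio_le (n : ℕ) (lam : ℂ) {x : ℝ} (hx : 0 < x) :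
    ‖Complex.cos (2 * lam * x) * (sinhRatio n x : ℂ)‖ ≤
      Real.exp (‖lam‖ * (2 * x)) * ((1 + 2 * x) * Real.exp (-(2 * x) / 2)) := by
  rw [norm_mul, Complex.norm_real, Real.norm_of_nonneg (sinhRatio_nonneg n hx)]
  refine mul_le_mul ?_ (sinhRatio_le_exp n hx) (sinhRatio_nonneg n hx) (Real.exp_pos _).le
  rw [← norm_two_mul_mul lam hx]
  exact norm_cos_le_exp _

theorem measurable_cos_mul_sinhRatio (n : ℕ) (lam : ℂ) :
    Measurable fun x : ℝ => Complex.cos (2 * lam * x) * (sinhRatio n x : ℂ) := by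
  have h1 := measurable_sinhRatio n
  have h2 := Complex.continuous_cos.measurable
  fun_prop

theorem integrableOn_cos_mul_sinhRatio (n : ℕ) {lam : ℂ} (hl : ‖lam‖ < 1 / 2) :
    IntegrableOn (fun x : ℝ => Complex.cos (2 * lam * x) * (sinhRatio n x : ℂ)) (Ioi 0) := by
  refine (integrableOn_majorant hl).mono'
    (measurable_cos_mul_sinhRatio n lam).aestronglyMeasurable ?_
  filter_upwards [ae_restrict_mem measurableSet_Ioi] with x hx
  exact norm_cos_mul_sinhRatio_le n lam hx

theorem tendsto_majorant {c : ℝ} (hc : c < 1 / 2) :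
    Tendsto (fun x => Real.exp (c * (2 * x)) * ((1 + 2 * x) * Real.exp (-(2 * x) / 2))) atTop
      (𝓝 0) := by
  obtain ⟨e, he, C, hC⟩ := exists_exp_mul_one_add_mul_exp_le hc
  have h1 : Tendsto (fun x : ℝ => C * Real.exp (-e * (2 * x))) atTop (𝓝 0) := by
    have h2 : Tendsto (fun x : ℝ => -e * (2 * x)) atTop atBot :=
      (tendsto_id.const_mul_atTop two_pos).const_mul_atTop_of_neg (neg_lt_zero.2 he)
    simpa using (Real.tendsto_exp_atBot.comp h2).const_mul C
  refine squeeze_zero' ?_ ?_ h1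
  · filter_upwards [eventually_gt_atTop 0] with x hx
    positivity
  · filter_upwards [eventually_gt_atTop 0] with x hx
    exact hC (2 * x) (by linarith)

/-- The boundary term in the two-fold integration by parts. -/
noncomputable def boundaryTerm (n : ℕ) (lam : ℂ) (x : ℝ) : ℂ :=
  Complex.cos (2 * lam * x) * (sinhRatioDeriv n x : ℂ) +
    2 * lam * Complex.sin (2 * lam * x) * (sinhRatio n x : ℂ)

/-- The Wronskian-type expression cos·f' - cos'·f has derivative cos·f'' - cos''·f, and the
differential equation replaces f''. Integrating this one derivative does both integrations by parts
at once. -/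
theorem hasDerivAt_boundaryTerm (n : ℕ) (lam : ℂ) {x : ℝ} (hx : 0 < x) :
    HasDerivAt (boundaryTerm n lam)
      (((2 * n + 1) ^ 2 + 4 * lam ^ 2) * (Complex.cos (2 * lam * x) * (sinhRatio n x : ℂ)) -
        (2 * n + 2) ^ 2 * (Complex.cos (2 * lam * x) * (sinhRatio (n + 1) x : ℂ))) x := by
  have hlin : HasDerivAt (fun x : ℝ => 2 * lam * (x : ℂ)) (2 * lam) x := by
    simpa using (Complex.ofRealCLM.hasDerivAt (x := x)).const_mul (2 * lam)
  have hcos := (Complex.hasDerivAt_cos (2 * lam * x)).comp x hlin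
  have hsin := (Complex.hasDerivAt_sin (2 * lam * x)).comp x hlin
  have hf := (hasDerivAt_sinhRatio n hx).ofReal_comp
  have hf' := (hasDerivAt_sinhRatioDeriv n hx).ofReal_comp
  refine ((hcos.mul hf').add ((hsin.const_mul (2 * lam)).mul hf)).congr_deriv ?_
  push_cast
  simp only [Function.comp]
  ring

theorem norm_boundaryTerm_le (n : ℕ) (lam : ℂ) {x : ℝ} (hx : 0 < x) :
    ‖boundaryTerm n lam x‖ ≤ (2 * n + 1 + 2 * ‖lam‖) *
      (Real.exp (‖lam‖ * (2 * x)) * ((1 + 2 * x) * Real.exp (-(2 * x) / 2))) := by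
  have h1 := norm_cos_le_exp (2 * lam * x)
  have h2 := norm_sin_le_exp (2 * lam * x)
  rw [norm_two_mul_mul lam hx] at h1 h2
  have h3 := abs_sinhRatioDeriv_le_exp n hx
  have h4 := sinhRatio_le_exp n hx
  have h5 := sinhRatio_nonneg n hx
  refine (norm_add_le _ _).trans ?_
  rw [norm_mul, norm_mul, norm_mul, norm_mul, Complex.norm_two, Complex.norm_real,
    Complex.norm_real, Real.norm_eq_abs, Real.norm_of_nonneg h5]
  have h6 := mul_le_mul h1 h3 (abs_nonneg _) (Real.exp_pos _).le
  have h7 : 2 * ‖lam‖ * ‖Complex.sin (2 * lam * x)‖ * sinhRatio n x ≤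
      2 * ‖lam‖ * Real.exp (‖lam‖ * (2 * x)) * ((1 + 2 * x) * Real.exp (-(2 * x) / 2)) := by
    gcongr
  linarith

theorem norm_boundaryTerm_le_self (n : ℕ) (lam : ℂ) {x : ℝ} (hx : 0 < x) :
    ‖boundaryTerm n lam x‖ ≤ ‖Complex.cos (2 * lam * x)‖ * ((2 * n + 1) * x) +
      ‖2 * lam * Complex.sin (2 * lam * x)‖ := by
  have h3 := abs_sinhRatioDeriv_le_self n hx
  have h4 := sinhRatio_le_one n hx
  have h5 := sinhRatio_nonneg n hx
  refine (norm_add_le _ _).trans ?_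
  rw [norm_mul, norm_mul _ (sinhRatio n x : ℂ), Complex.norm_real, Complex.norm_real,
    Real.norm_eq_abs, Real.norm_of_nonneg h5]
  exact add_le_add (mul_le_mul_of_nonneg_left h3 (norm_nonneg _))
    (mul_le_of_le_one_right (norm_nonneg _) h4)

/-- The derivative term vanishes here through division by sinh 0 = 0. This default value is also the
limit at 0+, by `norm_boundaryTerm_le_self`. -/
theorem boundaryTerm_zero (n : ℕ) (lam : ℂ) : boundaryTerm n lam 0 = 0 := by
  simp [boundaryTerm, sinhRatioDeriv]

theorem cosMoment_succ (n : ℕ) {lam : ℂ} (hl : ‖lam‖ < 1 / 2) :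
    (2 * n + 2) ^ 2 * cosMoment (n + 1) lam = ((2 * n + 1) ^ 2 + 4 * lam ^ 2) * cosMoment n lam := by
  have hi0 := (integrableOn_cos_mul_sinhRatio n hl).const_mul (((2 * n + 1) ^ 2 + 4 * lam ^ 2))
  have hi1 := (integrableOn_cos_mul_sinhRatio (n + 1) hl).const_mul ((2 * n + 2 : ℂ) ^ 2)
  have h := integral_Ioi_of_hasDerivAt_of_tendsto (f := boundaryTerm n lam) (a := 0) (m := 0) ?_
    (fun x hx => hasDerivAt_boundaryTerm n lam hx) (hi0.sub hi1) ?_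
  · rw [boundaryTerm_zero, sub_zero, integral_sub hi0 hi1, integral_const_mul,
      integral_const_mul] at h
    exact (sub_eq_zero.1 h).symm
  · rw [ContinuousWithinAt, boundaryTerm_zero]
    have hc : Tendsto (fun x : ℝ => ‖Complex.cos (2 * lam * x)‖ * ((2 * n + 1) * x) +
        ‖2 * lam * Complex.sin (2 * lam * x)‖) (𝓝[Ici 0] 0) (𝓝 0) := by
      have : Continuous (fun x : ℝ => ‖Complex.cos (2 * lam * x)‖ * ((2 * n + 1) * x) +
        ‖2 * lam * Complex.sin (2 * lam * x)‖) := by fun_prop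
      have := this.tendsto 0
      simp only [Complex.ofReal_zero, mul_zero, Complex.sin_zero, norm_zero, add_zero] at this
      exact this.mono_left nhdsWithin_le_nhds
    refine squeeze_zero_norm' ?_ hc
    filter_upwards [self_mem_nhdsWithin] with x hx
    rcases (show (0 : ℝ) ≤ x from hx).eq_or_lt with rfl | hx
    · simp [boundaryTerm_zero]
    · exact norm_boundaryTerm_le_self n lam hx
  · have := (tendsto_majorant hl).const_mul (2 * (n : ℝ) + 1 + 2 * ‖lam‖)
    rw [mul_zero] at this
    refine squeeze_zero_norm' ?_ this
    filter_upwards [eventually_gt_atTop 0] with x hx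
    exact norm_boundaryTerm_le n lam hx

/-- On the segment a + b = s the variable y = (a - b)/2 runs over (-s/2, s/2). The integrand
sinh^{2n} y is even, and the resulting 2 cancels the 1/2 in the weight. The remaining factor 2 comes
from s = 2x. -/
theorem integral_cosWeight_mul_ratio_pow (n : ℕ) {lam : ℂ} (hl : ‖lam‖ < 1 / 2) :
    ∫ x, cosWeight lam x * (ratio x : ℂ) ^ n ∂quadrant = 2 * cosMoment n lam := by
  set G : ℝ × ℝ → ℂ := fun z => Complex.cos (lam * (z.1 : ℂ)) *
    ((1 / (2 * Real.sinh (z.1 / 2)) *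
      ((Real.sinh (z.1 / 2 - z.2) / Real.sinh (z.1 / 2)) ^ 2) ^ n : ℝ) : ℂ) with hG
  have hGm : Measurable G := by
    have h1 := Real.continuous_sinh.measurable
    have h2 := Complex.continuous_cos.measurable
    fun_prop
  have hGe : (fun x : ℝ × ℝ => G (x.1 + x.2, x.2)) = fun x => cosWeight lam x * (ratio x : ℂ) ^ n := by
    ext x
    simp only [hG, cosWeight, weight, ratio]
    rw [show (x.1 + x.2) / 2 - x.2 = (x.1 - x.2) / 2 by ring]
    push_cast
    ring
  have hint : Integrable (fun x : ℝ × ℝ => G (x.1 + x.2, x.2)) quadrant := by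
    rw [hGe]
    have hmr := measurable_ratio
    have hmc := measurable_cosWeight lam
    refine (integrable_cosWeight hl).mono (by fun_prop) ?_
    filter_upwards [ae_quadrant] with x hx
    rw [norm_mul, norm_pow, Complex.norm_real, Real.norm_of_nonneg (ratio_nonneg x)]
    exact mul_le_of_le_one_right (norm_nonneg _) (pow_le_one₀ (ratio_nonneg x) (ratio_le_one hx))
  have h1 := integral_quadrant hint hGm
  rw [hGe] at h1
  rw [h1]
  have h2 : ∀ s ∈ Ioi (0 : ℝ), ∫ a in Ioo 0 s, G (s, a) =
      (fun x : ℝ => Complex.cos (2 * lam * x) * (sinhRatio n x : ℂ)) (2⁻¹ * s) := by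
    intro s hs
    have hs : 0 < s := hs
    have hsh : 0 < Real.sinh (s / 2) := Real.sinh_pos_iff.2 (by linarith)
    simp only [hG]
    rw [integral_const_mul, integral_complex_ofReal, ← integral_Ioc_eq_integral_Ioo,
      ← intervalIntegral.integral_of_le hs.le]
    have h3 : ∫ a in (0 : ℝ)..s, 1 / (2 * Real.sinh (s / 2)) *
        ((Real.sinh (s / 2 - a) / Real.sinh (s / 2)) ^ 2) ^ n = sinhRatio n (s / 2) := by
      have h4 : ∀ a, 1 / (2 * Real.sinh (s / 2)) *
          ((Real.sinh (s / 2 - a) / Real.sinh (s / 2)) ^ 2) ^ n =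
          (2 * Real.sinh (s / 2) ^ (2 * n + 1))⁻¹ * (fun y => Real.sinh y ^ (2 * n)) (s / 2 - a) := by
        intro a
        rw [← pow_mul, div_pow, pow_succ]
        field_simp
      simp_rw [h4]
      have hc : Continuous fun y => Real.sinh y ^ (2 * n) := Real.continuous_sinh.pow _
      rw [intervalIntegral.integral_const_mul,
        intervalIntegral.integral_comp_sub_left (fun y => Real.sinh y ^ (2 * n)),
        ← intervalIntegral.integral_add_adjacent_intervals (b := 0)
          (hc.intervalIntegrable _ _) (hc.intervalIntegrable _ _)]
      have h5 : ∫ y in (s / 2 - s)..0, Real.sinh y ^ (2 * n) = sinhIntegral n (s / 2) := by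
        have h6 := intervalIntegral.integral_comp_neg (a := 0) (b := s / 2)
          (fun y => Real.sinh y ^ (2 * n))
        rw [neg_zero] at h6
        rw [show s / 2 - s = -(s / 2) by ring, ← h6, sinhIntegral]
        simp_rw [Real.sinh_neg, (even_two_mul n).neg_pow]
      rw [h5, sub_zero, sinhRatio, sinhIntegral]
      field_simp
      ring
    rw [h3]
    push_cast
    rw [show 2 * lam * (2⁻¹ * (s : ℂ)) = lam * s by ring, show 2⁻¹ * s = s / 2 by ring]
  rw [setIntegral_congr_fun measurableSet_Ioi h2, integral_comp_mul_left_Ioi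
    (fun x : ℝ => Complex.cos (2 * lam * x) * (sinhRatio n x : ℂ)) 0 (by norm_num : (0 : ℝ) < 2⁻¹),
    inv_inv, mul_zero, cosMoment, Complex.real_smul]
  norm_num

/-! ### The zeroth moment -/

theorem self_mul_exp_neg_le {r x : ℝ} (hr : 0 < r) :
    x * Real.exp (-(r * x)) ≤ 2 / r * Real.exp (-(r / 2) * x) := by
  have h1 : x ≤ 2 / r * Real.exp (r / 2 * x) := by
    have h2 := Real.add_one_le_exp (r / 2 * x)
    calc x = 2 / r * (r / 2 * x) := by field_simp
      _ ≤ _ := by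
        gcongr
        linarith
  calc x * Real.exp (-(r * x)) ≤ 2 / r * Real.exp (r / 2 * x) * Real.exp (-(r * x)) := by gcongr
    _ = 2 / r * Real.exp (-(r / 2) * x) := by
      rw [mul_assoc, ← Real.exp_add]
      congr 2
      ring

theorem norm_self_mul_exp_neg_le {c : ℂ} (hc : 0 < c.re) {x : ℝ} (hx : 0 < x) :
    ‖(x : ℂ) * Complex.exp (-(c * x))‖ ≤ 2 / c.re * Real.exp (-(c.re / 2) * x) := by
  rw [norm_mul, Complex.norm_real, Real.norm_of_nonneg hx.le, Complex.norm_exp, Complex.neg_re,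
    Complex.re_mul_ofReal]
  exact self_mul_exp_neg_le hc

theorem tendsto_exp_neg_mul_atTop {r : ℝ} (hr : 0 < r) :
    Tendsto (fun x : ℝ => Real.exp (-r * x)) atTop (𝓝 0) :=
  Real.tendsto_exp_atBot.comp (tendsto_id.const_mul_atTop_of_neg (neg_lt_zero.2 hr))

theorem integrableOn_self_mul_exp_neg {c : ℂ} (hc : 0 < c.re) :
    IntegrableOn (fun x : ℝ => (x : ℂ) * Complex.exp (-(c * x))) (Ioi 0) := by
  refine ((exp_neg_integrableOn_Ioi 0 (half_pos hc)).const_mul (2 / c.re)).mono'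
    (Continuous.aestronglyMeasurable (by fun_prop)) ?_
  filter_upwards [ae_restrict_mem measurableSet_Ioi] with x hx
  exact norm_self_mul_exp_neg_le hc hx

theorem integral_self_mul_exp_neg {c : ℂ} (hc : 0 < c.re) :
    ∫ x in Ioi (0 : ℝ), (x : ℂ) * Complex.exp (-(c * x)) = 1 / c ^ 2 := by
  have hc0 : c ≠ 0 := by
    rintro rfl
    simp at hc
  have h := integral_Ioi_of_hasDerivAt_of_tendsto' (a := 0) (m := 0)
    (f := fun x : ℝ => -(1 / c) * ((x : ℂ) * Complex.exp (-(c * x))) -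
      1 / c ^ 2 * Complex.exp (-(c * x)))
    (f' := fun x : ℝ => (x : ℂ) * Complex.exp (-(c * x))) ?_ (integrableOn_self_mul_exp_neg hc) ?_
  · rw [h]
    simp
  · intro x _
    have h1 : HasDerivAt (fun x : ℝ => (x : ℂ)) 1 x := Complex.ofRealCLM.hasDerivAt
    have h2 : HasDerivAt (fun x : ℝ => Complex.exp (-(c * x)))
        (Complex.exp (-(c * x)) * -(c * 1)) x := (h1.const_mul c).neg.cexp
    refine (((h1.mul h2).const_mul (-(1 / c))).sub (h2.const_mul (1 / c ^ 2))).congr_deriv ?_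
    field_simp
    ring
  · have h1 : Tendsto (fun x : ℝ => (x : ℂ) * Complex.exp (-(c * x))) atTop (𝓝 0) := by
      have h2 := (tendsto_exp_neg_mul_atTop (half_pos hc)).const_mul (2 / c.re)
      rw [mul_zero] at h2
      refine squeeze_zero_norm' ?_ h2
      filter_upwards [eventually_gt_atTop 0] with x hx
      exact norm_self_mul_exp_neg_le hc hx
    have h2 : Tendsto (fun x : ℝ => Complex.exp (-(c * x))) atTop (𝓝 0) := by
      refine squeeze_zero_norm' ?_ (tendsto_exp_neg_mul_atTop hc)
      filter_upwards with x
      rw [Complex.norm_exp, Complex.neg_re, Complex.re_mul_ofReal, neg_mul]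
    have h3 := (h1.const_mul (-(1 / c))).sub (h2.const_mul (1 / c ^ 2))
    rw [mul_zero, mul_zero, sub_zero] at h3
    exact h3

theorem hasSum_div_sinh {x : ℝ} (hx : 0 < x) :
    HasSum (fun m : ℕ => 2 * x * Real.exp (-x) * Real.exp (-(2 * x)) ^ m) (x / Real.sinh x) := by
  have h1 : Real.exp (-(2 * x)) < 1 := Real.exp_lt_one_iff.2 (by linarith)
  have h2 := (hasSum_geometric_of_lt_one (Real.exp_pos _).le h1).mul_left (2 * x * Real.exp (-x))
  have h3 : x / Real.sinh x = 2 * x * Real.exp (-x) * (1 - Real.exp (-(2 * x)))⁻¹ := by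
    have h4 : Real.sinh x = (1 - Real.exp (-(2 * x))) * (Real.exp x / 2) := by
      rw [Real.sinh_eq, show -(2 * x) = -x + -x by ring, Real.exp_add]
      have : Real.exp (-x) * Real.exp x = 1 := by
        rw [← Real.exp_add]
        simp
      linear_combination (Real.exp (-x) / 2) * this
    have h5 : 1 - Real.exp (-(2 * x)) ≠ 0 := by linarith
    rw [h4, Real.exp_neg x]
    have := Real.exp_pos x
    field_simp
  rw [h3]
  exact h2

/-- Expand 1/sinh x = 2 Σ e^{-(2m+1)x} and integrate termwise; each half of the cosine shifts the
exponent by ±2iλ. -/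
theorem hasSum_cosMoment_zero {lam : ℂ} (hl : ‖lam‖ < 1 / 2) :
    HasSum (fun m : ℕ => 1 / (2 * (m : ℂ) + 1 - 2 * Complex.I * lam) ^ 2 +
      1 / (2 * (m : ℂ) + 1 + 2 * Complex.I * lam) ^ 2) (cosMoment 0 lam) := by
  have him : |(lam).im| < 1 / 2 := (Complex.abs_im_le_norm lam).trans_lt hl
  have hterm : ∀ m : ℕ, ∫ x in Ioi (0 : ℝ), Complex.cos (2 * lam * x) *
      ((2 * x * Real.exp (-x) * Real.exp (-(2 * x)) ^ m : ℝ) : ℂ) =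
      1 / (2 * (m : ℂ) + 1 - 2 * Complex.I * lam) ^ 2 +
      1 / (2 * (m : ℂ) + 1 + 2 * Complex.I * lam) ^ 2 := by
    intro m
    have hm : (0 : ℝ) ≤ m := m.cast_nonneg
    have h1 : 0 < (2 * (m : ℂ) + 1 - 2 * Complex.I * lam).re := by
      simp
      linarith [(abs_lt.1 him).1]
    have h2 : 0 < (2 * (m : ℂ) + 1 + 2 * Complex.I * lam).re := by
      simp
      linarith [(abs_lt.1 him).2]
    rw [← integral_self_mul_exp_neg h1, ← integral_self_mul_exp_neg h2, ← integral_add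
      (integrableOn_self_mul_exp_neg h1) (integrableOn_self_mul_exp_neg h2)]
    congr 1 with x
    push_cast
    rw [Complex.cos, ← Complex.exp_nat_mul,
      show -((2 * (m : ℂ) + 1 - 2 * Complex.I * lam) * x) =
        2 * lam * x * Complex.I + -x + m * -(2 * x) by ring,
      show -((2 * (m : ℂ) + 1 + 2 * Complex.I * lam) * x) =
        -(2 * lam * x) * Complex.I + -x + m * -(2 * x) by ring]
    simp only [Complex.exp_add]
    ring
  have h := hasSum_integral_of_dominated_convergence (μ := volume.restrict (Ioi (0 : ℝ)))
    (F := fun (m : ℕ) (x : ℝ) => Complex.cos (2 * lam * x) *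
      ((2 * x * Real.exp (-x) * Real.exp (-(2 * x)) ^ m : ℝ) : ℂ))
    (f := fun x : ℝ => Complex.cos (2 * lam * x) * (sinhRatio 0 x : ℂ))
    (fun m x => Real.exp (‖lam‖ * (2 * x)) *
      (2 * x * Real.exp (-x) * Real.exp (-(2 * x)) ^ m))
    (fun m => Continuous.aestronglyMeasurable (by fun_prop)) (fun m => ?_) ?_ ?_ ?_
  · simp_rw [hterm] at h
    exact h
  · filter_upwards [ae_restrict_mem measurableSet_Ioi] with x hx
    have hx : 0 < x := hx
    rw [norm_mul, Complex.norm_real, Real.norm_of_nonneg (by positivity),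
      ← norm_two_mul_mul lam hx]
    gcongr
    exact norm_cos_le_exp _
  · filter_upwards [ae_restrict_mem measurableSet_Ioi] with x hx
    exact (hasSum_div_sinh hx).summable.mul_left _
  · refine (integrableOn_majorant hl).mono' ?_ ?_
    · have h1 := measurable_sinhRatio 0
      refine AEStronglyMeasurable.congr
        (f := fun x => Real.exp (‖lam‖ * (2 * x)) * sinhRatio 0 x)
        (Measurable.aestronglyMeasurable (by fun_prop)) ?_
      filter_upwards [ae_restrict_mem measurableSet_Ioi] with x hx
      rw [tsum_mul_left, (hasSum_div_sinh hx).tsum_eq, sinhRatio_zero_left]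
    · filter_upwards [ae_restrict_mem measurableSet_Ioi] with x hx
      rw [tsum_mul_left, (hasSum_div_sinh hx).tsum_eq, ← sinhRatio_zero_left,
        Real.norm_of_nonneg (mul_nonneg (Real.exp_pos _).le (sinhRatio_nonneg 0 hx))]
      gcongr
      exact sinhRatio_le_exp 0 hx
  · filter_upwards [ae_restrict_mem measurableSet_Ioi] with x hx
    rw [sinhRatio_zero_left]
    exact (Complex.hasSum_ofReal.2 (hasSum_div_sinh hx)).mul_left _

/-- Derivative of the partial fraction expansion of π cot πz. -/
theorem tsum_one_div_add_int_sq {z : ℂ} (hz : 0 < z.im) :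
    ∑' n : ℤ, 1 / (z + n) ^ 2 = (Real.pi : ℂ) ^ 2 / Complex.sin (Real.pi * z) ^ 2 := by
  have h := iteratedDerivWithin_cot_pi_mul_eq_mul_tsum_div_pow (k := 1) le_rfl (z := z) hz
  have hz' : z ∈ Complex.integerComplement :=
    UpperHalfPlane.coe_mem_integerComplement ⟨z, hz⟩
  have hs := sin_pi_mul_ne_zero hz'
  have hd : HasDerivAt (fun x : ℂ => (Real.pi : ℂ) * Complex.cot (Real.pi * x))
      (-((Real.pi : ℂ) ^ 2 / Complex.sin (Real.pi * z) ^ 2)) z := by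
    have hlin : HasDerivAt (fun x : ℂ => (Real.pi : ℂ) * x) Real.pi z := by
      simpa using (hasDerivAt_id z).const_mul (Real.pi : ℂ)
    have h1 := (((Complex.hasDerivAt_cos (Real.pi * z)).comp z hlin).div
      ((Complex.hasDerivAt_sin (Real.pi * z)).comp z hlin) hs).const_mul (Real.pi : ℂ)
    refine h1.congr_deriv ?_
    simp only [Function.comp]
    have h2 := Complex.sin_sq_add_cos_sq (Real.pi * z)
    field_simp
    linear_combination -h2
  rw [iteratedDerivWithin_one,
    derivWithin_of_isOpen UpperHalfPlane.isOpen_upperHalfPlaneSet hz, hd.deriv] at h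
  simp only [pow_one, Nat.factorial_one, Nat.cast_one, mul_one, neg_mul, one_mul, neg_inj] at h
  exact h.symm

theorem cosMoment_zero_of_re_pos {lam : ℂ} (hl : ‖lam‖ < 1 / 2) (hre : 0 < lam.re) :
    cosMoment 0 lam = (Real.pi : ℂ) ^ 2 / (4 * Complex.cosh (Real.pi * lam) ^ 2) := by
  -- Here Im z = Re λ, hence the sign condition. The terms of index n and -(n+1) of the two-sided
  -- sum are the two terms of the moment series, up to the factor 4.
  set z : ℂ := 1 / 2 + Complex.I * lam with hz
  have hzim : 0 < z.im := by simpa [hz] using hre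
  have hsum : Summable fun n : ℤ => 1 / (z + n) ^ 2 := by
    have := EisensteinSeries.linear_right_summable z 1 (k := 2) le_rfl
    refine this.congr fun n => ?_
    simp [zpow_ofNat]
  have h1 : Summable fun n : ℕ => 1 / (z + (n : ℤ)) ^ 2 :=
    hsum.comp_injective (i := fun n : ℕ => (n : ℤ)) Nat.cast_injective
  have h2 : Summable fun n : ℕ => 1 / (z + ((-(n + 1 : ℤ) : ℤ) : ℂ)) ^ 2 :=
    hsum.comp_injective (i := fun n : ℕ => (-(n + 1 : ℤ))) fun a b hab => by simpa using hab
  have h3 := tsum_of_nat_of_neg_add_one (f := fun n : ℤ => 1 / (z + n) ^ 2) h1 h2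
  rw [← h1.tsum_add h2, tsum_one_div_add_int_sq hzim] at h3
  have h4 := (hasSum_cosMoment_zero hl).tsum_eq
  have h5 : ∀ n : ℕ, 1 / (2 * (n : ℂ) + 1 - 2 * Complex.I * lam) ^ 2 +
      1 / (2 * (n : ℂ) + 1 + 2 * Complex.I * lam) ^ 2 =
      1 / 4 * (1 / (z + (n : ℤ)) ^ 2 + 1 / (z + ((-(n + 1 : ℤ) : ℤ) : ℂ)) ^ 2) := by
    intro n
    push_cast
    have h6 : (z + n) ^ 2 = (2 * (n : ℂ) + 1 + 2 * Complex.I * lam) ^ 2 / 4 := by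
      rw [hz]
      ring
    have h7 : (z + -((n : ℂ) + 1)) ^ 2 = (2 * (n : ℂ) + 1 - 2 * Complex.I * lam) ^ 2 / 4 := by
      rw [hz]
      ring
    rw [h6, h7, one_div_div, one_div_div]
    ring
  rw [← h4, tsum_congr h5, tsum_mul_left, ← h3]
  have h6 : Complex.sin (Real.pi * z) = Complex.cosh (Real.pi * lam) := by
    rw [hz, show (Real.pi : ℂ) * (1 / 2 + Complex.I * lam) =
      Real.pi * lam * Complex.I + Real.pi / 2 by ring, Complex.sin_add_pi_div_two,
      Complex.cos_mul_I]
  rw [h6]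
  ring

theorem cosh_pi_mul_ne_zero {lam : ℂ} (hl : ‖lam‖ < 1 / 2) :
    Complex.cosh (Real.pi * lam) ≠ 0 := by
  rw [← Complex.cos_mul_I]
  intro h
  obtain ⟨k, hk⟩ := Complex.cos_eq_zero_iff.1 h
  have h1 : ‖(Real.pi : ℂ) * lam * Complex.I‖ = |(2 * (k : ℝ) + 1)| * Real.pi / 2 := by
    rw [hk, show (2 * (k : ℂ) + 1) * Real.pi / 2 = (((2 * (k : ℝ) + 1) * Real.pi / 2 : ℝ) : ℂ) by
      push_cast; ring, Complex.norm_real, Real.norm_eq_abs, abs_div, abs_mul,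
      abs_of_pos Real.pi_pos, abs_two]
  rw [norm_mul, norm_mul, Complex.norm_I, mul_one, Complex.norm_real,
    Real.norm_of_nonneg Real.pi_pos.le] at h1
  have h2 : (1 : ℝ) ≤ |2 * (k : ℝ) + 1| := by
    have : (1 : ℤ) ≤ |2 * k + 1| := Int.one_le_abs (by omega)
    exact_mod_cast this
  nlinarith [Real.pi_pos]

/-- Continuity extends the evaluation to the imaginary axis, which is where the parameters of the
torus integrals lie. -/
theorem continuousAt_cosMoment (n : ℕ) {lam : ℂ} (hl : ‖lam‖ < 1 / 2) :
    ContinuousAt (cosMoment n) lam := by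
  obtain ⟨c, hc1, hc2⟩ := exists_between hl
  refine continuousAt_of_dominated (bound := fun x => Real.exp (c * (2 * x)) *
    ((1 + 2 * x) * Real.exp (-(2 * x) / 2)))
    (Eventually.of_forall fun l => (measurable_cos_mul_sinhRatio n l).aestronglyMeasurable)
    ?_ (integrableOn_majorant hc2) (Eventually.of_forall fun x => by fun_prop)
  filter_upwards [(isOpen_lt continuous_norm continuous_const).mem_nhds hc1] with l hl
  filter_upwards [ae_restrict_mem measurableSet_Ioi] with x hx
  have hx : 0 < x := hx
  refine (norm_cos_mul_sinhRatio_le n l hx).trans ?_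
  have hl : ‖l‖ < c := hl
  gcongr

theorem cosMoment_neg (n : ℕ) (lam : ℂ) : cosMoment n (-lam) = cosMoment n lam := by
  simp only [cosMoment, mul_neg, neg_mul, Complex.cos_neg]

theorem cosMoment_zero_of_re_nonneg {lam : ℂ} (hl : ‖lam‖ < 1 / 2) (hre : 0 ≤ lam.re) :
    cosMoment 0 lam = (Real.pi : ℂ) ^ 2 / (4 * Complex.cosh (Real.pi * lam) ^ 2) := by
  -- Approach `lam` from the right, where the real part is positive.
  have hpath : Tendsto (fun e : ℝ => lam + e) (𝓝[>] 0) (𝓝 lam) := by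
    have : Continuous fun e : ℝ => lam + e := by fun_prop
    have := this.tendsto 0
    simp only [Complex.ofReal_zero, add_zero] at this
    exact this.mono_left nhdsWithin_le_nhds
  have h1 := (continuousAt_cosMoment 0 hl).tendsto.comp hpath
  have h2 : ContinuousAt (fun lam : ℂ =>
      (Real.pi : ℂ) ^ 2 / (4 * Complex.cosh (Real.pi * lam) ^ 2)) lam := by
    refine ContinuousAt.div (by fun_prop) (by fun_prop) ?_
    exact mul_ne_zero (by norm_num) (pow_ne_zero _ (cosh_pi_mul_ne_zero hl))
  refine tendsto_nhds_unique h1 ((h2.tendsto.comp hpath).congr' ?_)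
  filter_upwards [hpath.eventually ((isOpen_lt continuous_norm continuous_const).mem_nhds hl),
    self_mem_nhdsWithin] with e he1 he2
  have he2 : 0 < e := he2
  exact (cosMoment_zero_of_re_pos he1 (by simp; linarith)).symm

theorem cosMoment_zero {lam : ℂ} (hl : ‖lam‖ < 1 / 2) :
    cosMoment 0 lam = (Real.pi : ℂ) ^ 2 / (4 * Complex.cosh (Real.pi * lam) ^ 2) := by
  rcases le_total 0 lam.re with h | h
  · exact cosMoment_zero_of_re_nonneg hl h
  · rw [← cosMoment_neg, cosMoment_zero_of_re_nonneg (by rwa [norm_neg]) (by simpa using h),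
      mul_neg, Complex.cosh_neg]

/-! ### The hypergeometric expression -/

/-- The recursion factor splits as (2n+1)² + 4λ² = 4(n + 1/2 + iλ)(n + 1/2 - iλ), giving the two
Pochhammer symbols. -/
theorem cosMoment_eq (n : ℕ) {lam : ℂ} (hl : ‖lam‖ < 1 / 2) :
    cosMoment n lam = cosMoment 0 lam * (((n.factorial : ℂ)⁻¹) *
      (ascPochhammer ℂ n).eval (1 / 2 + Complex.I * lam) *
      (ascPochhammer ℂ n).eval (1 / 2 - Complex.I * lam) * (n.factorial : ℂ)⁻¹) := by
  induction n with
  | zero => simp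
  | succ n ih =>
    have h := cosMoment_succ n hl
    have h0 : (2 * (n : ℂ) + 2) ≠ 0 := by exact_mod_cast (by omega : 2 * n + 2 ≠ 0)
    have h1 : (n : ℂ) + 1 ≠ 0 := by exact_mod_cast (by omega : n + 1 ≠ 0)
    have hf : (n.factorial : ℂ) ≠ 0 := by exact_mod_cast n.factorial_ne_zero
    rw [ih] at h
    rw [ascPochhammer_succ_eval, ascPochhammer_succ_eval, Nat.factorial_succ]
    push_cast
    refine mul_left_cancel₀ (pow_ne_zero 2 h0) (h.trans ?_)
    have hI := Complex.I_sq
    generalize (ascPochhammer ℂ n).eval (1 / 2 + Complex.I * lam) = A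
    generalize (ascPochhammer ℂ n).eval (1 / 2 - Complex.I * lam) = B
    field_simp
    linear_combination 4 * lam ^ 2 * cosMoment 0 lam * A * B * hI

/-- The value of the even meta-generating function at `t = 0`. -/
noncomputable def coshFactor (lam : ℂ) : ℂ :=
  (Real.pi : ℂ) ^ 2 / (2 * Complex.cosh (Real.pi * lam) ^ 2)

theorem coshFactor_ne_zero {lam : ℂ} (hl : ‖lam‖ < 1 / 2) : coshFactor lam ≠ 0 :=
  div_ne_zero (pow_ne_zero _ (by exact_mod_cast Real.pi_ne_zero))
    (mul_ne_zero two_ne_zero (pow_ne_zero _ (cosh_pi_mul_ne_zero hl)))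

theorem hasSum_ordinaryHypergeometric {t lam : ℂ} (ht : ‖t‖ < 1) (hl : ‖lam‖ < 1 / 2) :
    HasSum (fun n : ℕ => ((n.factorial : ℂ)⁻¹ *
      (ascPochhammer ℂ n).eval (1 / 2 + Complex.I * lam) *
      (ascPochhammer ℂ n).eval (1 / 2 - Complex.I * lam) * (n.factorial : ℂ)⁻¹) * t ^ n)
      ((coshFactor lam)⁻¹ * ratioIntegral (cosWeight lam) t) := by
  have h := (hasSum_ratioIntegral (integrable_cosWeight hl) ht).mul_left (coshFactor lam)⁻¹
  have h0 : coshFactor lam = 2 * cosMoment 0 lam := by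
    rw [cosMoment_zero hl, coshFactor]
    ring
  have hterm : ∀ n : ℕ, (coshFactor lam)⁻¹ *
      ((∫ x, cosWeight lam x * (ratio x : ℂ) ^ n ∂quadrant) * t ^ n) =
      ((n.factorial : ℂ)⁻¹ * (ascPochhammer ℂ n).eval (1 / 2 + Complex.I * lam) *
        (ascPochhammer ℂ n).eval (1 / 2 - Complex.I * lam) * (n.factorial : ℂ)⁻¹) * t ^ n := by
    intro n
    rw [integral_cosWeight_mul_ratio_pow n hl, cosMoment_eq n hl, ← mul_assoc, ← mul_assoc 2,
      ← h0, ← mul_assoc, inv_mul_cancel₀ (coshFactor_ne_zero hl), one_mul]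
  simpa only [hterm] using h

theorem isContinuation_ordinaryHypergeometric {lam : ℂ} (hl : ‖lam‖ < 1 / 2) :
    IsContinuation
      (fun t => ordinaryHypergeometric (1 / 2 + Complex.I * lam) (1 / 2 - Complex.I * lam) 1 t)
      (fun t => (coshFactor lam)⁻¹ * ratioIntegral (cosWeight lam) t) := by
  refine ⟨analyticOnNhd_const.mul (analyticOnNhd_ratioIntegral (integrable_cosWeight hl)), ?_⟩
  filter_upwards [Metric.ball_mem_nhds (0 : ℂ) one_pos] with t ht
  rw [← (hasSum_ordinaryHypergeometric (by simpa using ht) hl).tsum_eq,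
    ordinaryHypergeometric_eq_tsum]
  refine tsum_congr fun n => ?_
  simp [ascPochhammer_eval_one]

theorem hyp_eq {t lam : ℂ} (ht : t ∈ cutPlane) (hl : ‖lam‖ < 1 / 2) :
    hyp (1 / 2 + Complex.I * lam) (1 / 2 - Complex.I * lam) 1 t =
      (coshFactor lam)⁻¹ * ratioIntegral (cosWeight lam) t :=
  principalBranch_eq (isContinuation_ordinaryHypergeometric hl) ht

theorem Ve_eq_ratioIntegral {t lam : ℂ} (ht : t ∈ cutPlane) (hl : ‖lam‖ < 1 / 2) :
    Ve t lam = ratioIntegral (cosWeight lam) t :=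
  (hasSum_VeTerm ht hl).tsum_eq

theorem Ve_eq {t lam : ℂ} (ht : t ∈ cutPlane) (hl : ‖lam‖ < 1 / 2) :
    Ve t lam = coshFactor lam *
      hyp (1 / 2 + Complex.I * lam) (1 / 2 - Complex.I * lam) 1 t := by
  rw [hyp_eq ht hl, mul_inv_cancel_left₀ (coshFactor_ne_zero hl), Ve_eq_ratioIntegral ht hl]

/-! ### Means over the torus -/

/-- Lebesgue measure on `[0, 2π]²`. -/
noncomputable def torusMeasure : Measure (Fin 2 → ℝ) :=
  Measure.pi fun _ => volume.restrict (Icc 0 (2 * Real.pi))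

instance : IsFiniteMeasure torusMeasure := by
  unfold torusMeasure
  infer_instance

theorem torusMeasure_eq :
    torusMeasure = volume.restrict (Icc (0 : Fin 2 → ℝ) fun _ => 2 * Real.pi) := by
  have h : (Icc (0 : Fin 2 → ℝ) fun _ => 2 * Real.pi) = univ.pi fun _ => Icc 0 (2 * Real.pi) := by
    rw [pi_univ_Icc]
    rfl
  rw [h, torusMeasure, volume_pi, Measure.restrict_pi_pi]

/-- The point `e^{iθ}` of the unit circle. -/
noncomputable def unitExp (θ : ℝ) : ℂ := Complex.exp (θ * Complex.I)

theorem continuous_unitExp : Continuous unitExp := by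
  unfold unitExp
  fun_prop

theorem unitExp_ne_zero (θ : ℝ) : unitExp θ ≠ 0 := Complex.exp_ne_zero _

theorem norm_unitExp (θ : ℝ) : ‖unitExp θ‖ = 1 := Complex.norm_exp_ofReal_mul_I θ

theorem integral_unitExp_zpow (a : ℤ) :
    ∫ θ in Icc 0 (2 * Real.pi), unitExp θ ^ a = if a = 0 then 2 * (Real.pi : ℂ) else 0 := by
  rw [integral_Icc_eq_integral_Ioc, ← intervalIntegral.integral_of_le (by positivity)]
  split_ifs with ha
  · subst ha
    simp
  · have h0 : (a : ℂ) * Complex.I ≠ 0 := mul_ne_zero (by exact_mod_cast ha) Complex.I_ne_zero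
    have h1 : ∀ θ : ℝ, unitExp θ ^ a = Complex.exp ((a : ℂ) * Complex.I * θ) := by
      intro θ
      rw [unitExp, ← Complex.exp_int_mul]
      ring_nf
    simp_rw [h1]
    rw [integral_exp_mul_complex h0]
    have h2 : Complex.exp ((a : ℂ) * Complex.I * ((2 * Real.pi : ℝ) : ℂ)) = 1 := by
      rw [Complex.exp_eq_one_iff]
      exact ⟨a, by push_cast; ring⟩
    rw [h2]
    simp

theorem integral_unitExp_zpow_mul (a b : ℤ) :
    ∫ θ, 1 / (2 * (Real.pi : ℂ)) ^ 2 * (unitExp (θ 0) ^ a * unitExp (θ 1) ^ b) ∂torusMeasure =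
      if a = 0 ∧ b = 0 then 1 else 0 := by
  have h := integral_fintype_prod_eq_prod (ι := Fin 2) (𝕜 := ℂ)
    (fun i θ => unitExp θ ^ (![a, b] i)) (μ := fun _ => volume.restrict (Icc 0 (2 * Real.pi)))
  simp only [Fin.prod_univ_two, Matrix.cons_val_zero, Matrix.cons_val_one] at h
  rw [integral_const_mul, torusMeasure, h, integral_unitExp_zpow, integral_unitExp_zpow]
  have hpi : (Real.pi : ℂ) ≠ 0 := by exact_mod_cast Real.pi_ne_zero
  by_cases ha : a = 0 <;> by_cases hb : b = 0 <;> simp [ha, hb]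
  field_simp

theorem integrable_of_continuous_torusMeasure {F : (Fin 2 → ℝ) → ℂ} (hF : Continuous F) :
    Integrable F torusMeasure := by
  rw [torusMeasure_eq]
  exact hF.continuousOn.integrableOn_compact isCompact_Icc

theorem continuous_unitExp_zpow (i : Fin 2) (a : ℤ) :
    Continuous fun θ : Fin 2 → ℝ => unitExp (θ i) ^ a :=
  (continuous_unitExp.comp (continuous_apply i)).zpow₀ a fun θ => Or.inl (unitExp_ne_zero (θ i))

theorem integral_sum_sum_unitExp (s : Finset ℕ) (t : ℕ → Finset ℕ) (c : ℕ → ℕ → ℂ)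
    (a b : ℕ → ℕ → ℤ) :
    ∫ θ, 1 / (2 * (Real.pi : ℂ)) ^ 2 * ∑ i ∈ s, ∑ j ∈ t i,
        c i j * (unitExp (θ 0) ^ a i j * unitExp (θ 1) ^ b i j) ∂torusMeasure =
      ∑ i ∈ s, ∑ j ∈ t i, if a i j = 0 ∧ b i j = 0 then c i j else 0 := by
  have hc : ∀ i j, Continuous fun θ : Fin 2 → ℝ => 1 / (2 * (Real.pi : ℂ)) ^ 2 *
      (c i j * (unitExp (θ 0) ^ a i j * unitExp (θ 1) ^ b i j)) := fun i j =>
    continuous_const.mul (continuous_const.mul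
      ((continuous_unitExp_zpow 0 _).mul (continuous_unitExp_zpow 1 _)))
  simp_rw [Finset.mul_sum]
  rw [integral_finsetSum _ fun i _ => integrable_of_continuous_torusMeasure
    (continuous_finsetSum _ fun j _ => hc i j)]
  refine Finset.sum_congr rfl fun i _ => ?_
  rw [integral_finsetSum _ fun j _ => integrable_of_continuous_torusMeasure (hc i j)]
  refine Finset.sum_congr rfl fun j _ => ?_
  have h : ∀ θ : Fin 2 → ℝ, 1 / (2 * (Real.pi : ℂ)) ^ 2 *
      (c i j * (unitExp (θ 0) ^ a i j * unitExp (θ 1) ^ b i j)) =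
      c i j * (1 / (2 * (Real.pi : ℂ)) ^ 2 *
        (unitExp (θ 0) ^ a i j * unitExp (θ 1) ^ b i j)) := fun θ => by ring
  simp_rw [h]
  rw [integral_const_mul, integral_unitExp_zpow_mul]
  split_ifs <;> simp

theorem u_eq (l : ℕ) (lam : ℂ) :
    u l lam = ∫ θ, 1 / (2 * (Real.pi : ℂ)) ^ 2 /
      (1 - lam * P l (unitExp (θ 0)) (unitExp (θ 1))) ∂torusMeasure := by
  rw [u, torusIntegral, torusMeasure_eq, ← integral_const_mul]
  congr 1 with θ
  have h0 := unitExp_ne_zero (θ 0)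
  have h1 := unitExp_ne_zero (θ 1)
  have hpi : (Real.pi : ℂ) ≠ 0 := by exact_mod_cast Real.pi_ne_zero
  have hm : ∀ i, torusMap 0 1 θ i = unitExp (θ i) := fun i => by simp [torusMap, unitExp]
  simp only [hm, Fin.prod_univ_two, Pi.one_apply, Complex.ofReal_one, one_mul, smul_eq_mul]
  change _ * (unitExp (θ 0) * Complex.I * (unitExp (θ 1) * Complex.I) * _) = _
  have hI := Complex.I_sq
  rw [mul_pow _ Complex.I, hI]
  field_simp
  rw [hI]
  ring

/-! ### Moments of the Laurent polynomials -/

/-- The `n`-th moment of `P_l` over the torus: the constant term of `P_l ^ n`. -/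
noncomputable def torusMoment (l n : ℕ) : ℂ :=
  ∫ θ, 1 / (2 * (Real.pi : ℂ)) ^ 2 * P l (unitExp (θ 0)) (unitExp (θ 1)) ^ n ∂torusMeasure

theorem torusMoment_eq_sum {l n : ℕ} (s : Finset ℕ) (t : ℕ → Finset ℕ) (c : ℕ → ℕ → ℂ)
    (a b : ℕ → ℕ → ℤ)
    (h : ∀ x y : ℂ, x ≠ 0 → y ≠ 0 →
      P l x y ^ n = ∑ i ∈ s, ∑ j ∈ t i, c i j * (x ^ a i j * y ^ b i j)) :
    torusMoment l n = ∑ i ∈ s, ∑ j ∈ t i, if a i j = 0 ∧ b i j = 0 then c i j else 0 := by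
  rw [torusMoment, ← integral_sum_sum_unitExp]
  simp_rw [h _ _ (unitExp_ne_zero _) (unitExp_ne_zero _)]

theorem P_two_pow {x y : ℂ} (hx : x ≠ 0) (hy : y ≠ 0) (n : ℕ) :
    P 2 x y ^ n = ∑ i ∈ Finset.range (n + 1), ∑ j ∈ Finset.range (n + 1),
      ((n.choose i : ℂ) * n.choose j) *
        (x ^ ((i : ℤ) + j - n) * y ^ ((i : ℤ) + (n - j) - n)) := by
  -- This factorization makes the power a product of two binomial expansions, whence the squared
  -- central binomial coefficient.
  have h : P 2 x y = (x * y + 1) * (x + y) / (x * y) := by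
    simp only [P]
    field_simp
    ring
  rw [h, div_pow, mul_pow, add_pow, add_pow, Finset.sum_mul_sum, Finset.sum_div]
  refine Finset.sum_congr rfl fun i hi => ?_
  rw [Finset.sum_div]
  refine Finset.sum_congr rfl fun j hj => ?_
  have hj' : j ≤ n := Nat.lt_succ_iff.1 (Finset.mem_range.1 hj)
  rw [zpow_sub₀ hx, zpow_sub₀ hy, zpow_add₀ hx, zpow_add₀ hy, ← Nat.cast_sub hj']
  simp only [zpow_natCast, one_pow, mul_pow]
  field_simp

theorem P_three_pow {x y : ℂ} (hx : x ≠ 0) (hy : y ≠ 0) (n : ℕ) :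
    P 3 x y ^ n = ∑ i ∈ Finset.range (n + 1), ∑ j ∈ Finset.range (i + 1),
      ((n.choose i : ℂ) * i.choose j) * (x ^ (3 * ((n : ℤ) - i) - n) * y ^ (3 * (j : ℤ) - n)) := by
  have h : P 3 x y = (y ^ 3 + 1 + x ^ 3) / (x * y) := by
    simp only [P]
    field_simp
    ring
  rw [h, div_pow, add_pow, Finset.sum_div]
  refine Finset.sum_congr rfl fun i hi => ?_
  have hi' : i ≤ n := Nat.lt_succ_iff.1 (Finset.mem_range.1 hi)
  rw [add_pow, Finset.sum_mul, Finset.sum_mul, Finset.sum_div]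
  refine Finset.sum_congr rfl fun j hj => ?_
  rw [zpow_sub₀ hx, zpow_sub₀ hy, ← Nat.cast_sub hi', zpow_mul, zpow_mul]
  simp only [zpow_natCast, zpow_ofNat, one_pow, mul_pow]
  field_simp

theorem P_four_pow {x y : ℂ} (hx : x ≠ 0) (hy : y ≠ 0) (n : ℕ) :
    P 4 x y ^ n = ∑ i ∈ Finset.range (n + 1), ∑ j ∈ Finset.range (i + 1),
      ((n.choose i : ℂ) * i.choose j) *
        (x ^ (2 * (i : ℤ) - n) * y ^ (4 * (j : ℤ) + 2 * ((n : ℤ) - i) - 2 * n)) := by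
  have h : P 4 x y = (x ^ 2 * (y ^ 4 + 1) + y ^ 2) / (x * y ^ 2) := by
    simp only [P]
    field_simp
  rw [h, div_pow, add_pow, Finset.sum_div]
  refine Finset.sum_congr rfl fun i hi => ?_
  have hi' : i ≤ n := Nat.lt_succ_iff.1 (Finset.mem_range.1 hi)
  rw [mul_pow, add_pow, Finset.mul_sum, Finset.sum_mul, Finset.sum_mul, Finset.sum_div]
  refine Finset.sum_congr rfl fun j hj => ?_
  rw [zpow_sub₀ hx, zpow_sub₀ hy, zpow_add₀ hy, ← Nat.cast_sub hi', zpow_mul, zpow_mul, zpow_mul,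
    zpow_mul]
  simp only [zpow_natCast, zpow_ofNat, one_pow, mul_pow]
  field_simp

theorem P_six_pow {x y : ℂ} (hx : x ≠ 0) (hy : y ≠ 0) (n : ℕ) :
    P 6 x y ^ n = ∑ i ∈ Finset.range (n + 1), ∑ j ∈ Finset.range (i + 1),
      ((-1) ^ i * (n.choose i : ℂ) * i.choose j) *
        (x ^ (3 * ((n : ℤ) - i) - n) * y ^ (2 * (j : ℤ) - n)) := by
  have h : P 6 x y = (-1 * (y ^ 2 + 1) + x ^ 3) / (x * y) := by
    simp only [P]
    field_simp
    ring
  rw [h, div_pow, add_pow, Finset.sum_div]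
  refine Finset.sum_congr rfl fun i hi => ?_
  have hi' : i ≤ n := Nat.lt_succ_iff.1 (Finset.mem_range.1 hi)
  rw [mul_pow, add_pow, Finset.mul_sum, Finset.sum_mul, Finset.sum_mul, Finset.sum_div]
  refine Finset.sum_congr rfl fun j hj => ?_
  rw [zpow_sub₀ hx, zpow_sub₀ hy, ← Nat.cast_sub hi', zpow_mul, zpow_mul]
  simp only [zpow_natCast, zpow_ofNat, one_pow, mul_pow]
  field_simp

/-! ### Constant terms: at most one monomial has both exponents zero. -/

theorem sum_sum_ite_eq {s : Finset ℕ} {t : ℕ → Finset ℕ} {c : ℕ → ℕ → ℂ} {p : ℕ → ℕ → Prop}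
    [∀ i j, Decidable (p i j)] {i₀ j₀ : ℕ} (hi : i₀ ∈ s) (hj : j₀ ∈ t i₀) (hp : p i₀ j₀)
    (h : ∀ i ∈ s, ∀ j ∈ t i, p i j → i = i₀ ∧ j = j₀) :
    ∑ i ∈ s, ∑ j ∈ t i, (if p i j then c i j else 0) = c i₀ j₀ := by
  rw [Finset.sum_eq_single_of_mem i₀ hi, Finset.sum_eq_single_of_mem j₀ hj, if_pos hp]
  · exact fun j hj hne => if_neg fun hp => hne (h _ hi _ hj hp).2
  · exact fun i hi hne => Finset.sum_eq_zero fun j hj => if_neg fun hp => hne (h _ hi _ hj hp).1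

theorem sum_sum_ite_eq_zero {s : Finset ℕ} {t : ℕ → Finset ℕ} {c : ℕ → ℕ → ℂ} {p : ℕ → ℕ → Prop}
    [∀ i j, Decidable (p i j)] (h : ∀ i ∈ s, ∀ j ∈ t i, ¬ p i j) :
    ∑ i ∈ s, ∑ j ∈ t i, (if p i j then c i j else 0) = 0 :=
  Finset.sum_eq_zero fun i hi => Finset.sum_eq_zero fun j hj => if_neg (h i hi j hj)

/-- Vanishing of both exponents is a pair of linear equations, solvable in integers only if l
divides n. -/
theorem torusMoment_eq_zero {l n : ℕ} (hl : l = 2 ∨ l = 3 ∨ l = 4 ∨ l = 6) (h : ¬ l ∣ n) :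
    torusMoment l n = 0 := by
  rcases hl with rfl | rfl | rfl | rfl
  · rw [torusMoment_eq_sum _ _ _ _ _ fun x y hx hy => P_two_pow hx hy n]
    exact sum_sum_ite_eq_zero fun i _ j _ h => by omega
  · rw [torusMoment_eq_sum _ _ _ _ _ fun x y hx hy => P_three_pow hx hy n]
    exact sum_sum_ite_eq_zero fun i _ j _ h => by omega
  · rw [torusMoment_eq_sum _ _ _ _ _ fun x y hx hy => P_four_pow hx hy n]
    exact sum_sum_ite_eq_zero fun i _ j _ h => by omega
  · rw [torusMoment_eq_sum _ _ _ _ _ fun x y hx hy => P_six_pow hx hy n]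
    exact sum_sum_ite_eq_zero fun i _ j _ h => by omega

theorem torusMoment_two (m : ℕ) :
    torusMoment 2 (2 * m) = ((2 * m).choose m : ℂ) * (2 * m).choose m := by
  rw [torusMoment_eq_sum _ _ _ _ _ fun x y hx hy => P_two_pow hx hy (2 * m)]
  refine sum_sum_ite_eq (i₀ := m) (j₀ := m) ?_ ?_ ?_ ?_
  · simp; omega
  · simp; omega
  · omega
  · intro i _ j _ h
    omega

theorem torusMoment_three (m : ℕ) :
    torusMoment 3 (3 * m) = ((3 * m).choose (2 * m) : ℂ) * (2 * m).choose m := by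
  rw [torusMoment_eq_sum _ _ _ _ _ fun x y hx hy => P_three_pow hx hy (3 * m)]
  refine sum_sum_ite_eq (i₀ := 2 * m) (j₀ := m) ?_ ?_ ?_ ?_
  · simp; omega
  · simp; omega
  · omega
  · intro i _ j _ h
    omega

theorem torusMoment_four (m : ℕ) :
    torusMoment 4 (4 * m) = ((4 * m).choose (2 * m) : ℂ) * (2 * m).choose m := by
  rw [torusMoment_eq_sum _ _ _ _ _ fun x y hx hy => P_four_pow hx hy (4 * m)]
  refine sum_sum_ite_eq (i₀ := 2 * m) (j₀ := m) ?_ ?_ ?_ ?_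
  · simp; omega
  · simp; omega
  · omega
  · intro i _ j _ h
    omega

theorem torusMoment_six (m : ℕ) :
    torusMoment 6 (6 * m) = ((6 * m).choose (4 * m) : ℂ) * (4 * m).choose (3 * m) := by
  rw [torusMoment_eq_sum _ _ _ _ _ fun x y hx hy => P_six_pow hx hy (6 * m)]
  rw [sum_sum_ite_eq (i₀ := 4 * m) (j₀ := 3 * m), (even_iff_two_dvd.2 ⟨2 * m, by ring⟩).neg_one_pow,
    one_mul]
  · simp; omega
  · simp; omega
  · omega
  · intro i _ j _ h
    omega

/-! ### Multiplication formulas for Pochhammer symbols -/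

theorem factorial_two_mul (m : ℕ) :
    ((2 * m).factorial : ℂ) = 4 ^ m * (ascPochhammer ℂ m).eval (1 / 2) * m.factorial := by
  induction m with
  | zero => simp
  | succ m ih =>
    rw [ascPochhammer_succ_eval, show 2 * (m + 1) = 2 * m + 1 + 1 by ring, Nat.factorial_succ,
      Nat.factorial_succ, Nat.factorial_succ]
    push_cast
    rw [ih]
    ring

theorem factorial_three_mul (m : ℕ) :
    ((3 * m).factorial : ℂ) = 27 ^ m * (ascPochhammer ℂ m).eval (1 - 1 / 3) *
      (ascPochhammer ℂ m).eval (1 / 3) * m.factorial := by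
  induction m with
  | zero => simp
  | succ m ih =>
    rw [ascPochhammer_succ_eval, ascPochhammer_succ_eval,
      show 3 * (m + 1) = 3 * m + 1 + 1 + 1 by ring]
    simp only [Nat.factorial_succ]
    push_cast
    rw [ih]
    ring

theorem factorial_four_mul (m : ℕ) :
    ((4 * m).factorial : ℂ) = 64 ^ m * (ascPochhammer ℂ m).eval (1 - 1 / 4) *
      (ascPochhammer ℂ m).eval (1 / 4) * (2 * m).factorial := by
  induction m with
  | zero => simp
  | succ m ih =>
    rw [ascPochhammer_succ_eval, ascPochhammer_succ_eval,
      show 4 * (m + 1) = 4 * m + 1 + 1 + 1 + 1 by ring, show 2 * (m + 1) = 2 * m + 1 + 1 by ring]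
    simp only [Nat.factorial_succ]
    push_cast
    rw [ih]
    ring

theorem factorial_six_mul (m : ℕ) :
    ((6 * m).factorial : ℂ) * m.factorial = 432 ^ m * (ascPochhammer ℂ m).eval (1 - 1 / 6) *
      (ascPochhammer ℂ m).eval (1 / 6) * (3 * m).factorial * (2 * m).factorial := by
  induction m with
  | zero => simp
  | succ m ih =>
    rw [ascPochhammer_succ_eval, ascPochhammer_succ_eval,
      show 6 * (m + 1) = 6 * m + 1 + 1 + 1 + 1 + 1 + 1 by ring,
      show 3 * (m + 1) = 3 * m + 1 + 1 + 1 by ring, show 2 * (m + 1) = 2 * m + 1 + 1 by ring]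
    simp only [Nat.factorial_succ]
    push_cast
    linear_combination (6 * (m : ℂ) + 1 + 1 + 1 + 1 + 1 + 1) * (6 * m + 1 + 1 + 1 + 1 + 1) *
      (6 * m + 1 + 1 + 1 + 1) * (6 * m + 1 + 1 + 1) * (6 * m + 1 + 1) * (6 * m + 1) * (m + 1) * ih

theorem torusMoment_eq {l : ℕ} (hl : l = 2 ∨ l = 3 ∨ l = 4 ∨ l = 6) (m : ℕ) :
    torusMoment l (l * m) = (m.factorial : ℂ)⁻¹ * (ascPochhammer ℂ m).eval (1 - 1 / (l : ℂ)) *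
      (ascPochhammer ℂ m).eval (1 / (l : ℂ)) * (m.factorial : ℂ)⁻¹ * C l ^ m := by
  have hf : ∀ k : ℕ, (k.factorial : ℂ) ≠ 0 := fun k => by exact_mod_cast k.factorial_ne_zero
  have h1 := hf m
  have h2 := hf (2 * m)
  have h3 := hf (3 * m)
  have h4 := hf (4 * m)
  rcases hl with rfl | rfl | rfl | rfl
  · rw [torusMoment_two, Nat.cast_choose ℂ (by omega : m ≤ 2 * m), show 2 * m - m = m by omega,
      factorial_two_mul, C, show (2 : ℂ) ^ 4 = 4 * 4 by norm_num, mul_pow,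
      show 1 - 1 / ((2 : ℕ) : ℂ) = 1 / 2 by norm_num, show 1 / ((2 : ℕ) : ℂ) = 1 / 2 by norm_num]
    generalize (ascPochhammer ℂ m).eval (1 / 2) = A
    field_simp
  · rw [torusMoment_three, Nat.cast_choose ℂ (by omega : 2 * m ≤ 3 * m),
      Nat.cast_choose ℂ (by omega : m ≤ 2 * m), show 3 * m - 2 * m = m by omega,
      show 2 * m - m = m by omega, factorial_three_mul, C, show (3 : ℂ) ^ 3 = 27 by norm_num,
      Nat.cast_ofNat]
    generalize (ascPochhammer ℂ m).eval (1 / 3) = A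
    generalize (ascPochhammer ℂ m).eval (1 - 1 / 3) = B
    field_simp
  · rw [torusMoment_four, Nat.cast_choose ℂ (by omega : 2 * m ≤ 4 * m),
      Nat.cast_choose ℂ (by omega : m ≤ 2 * m), show 4 * m - 2 * m = 2 * m by omega,
      show 2 * m - m = m by omega, factorial_four_mul, C, show (2 : ℂ) ^ 6 = 64 by norm_num,
      Nat.cast_ofNat]
    generalize (ascPochhammer ℂ m).eval (1 / 4) = A
    generalize (ascPochhammer ℂ m).eval (1 - 1 / 4) = B
    field_simp
  · have h := factorial_six_mul m
    rw [torusMoment_six, Nat.cast_choose ℂ (by omega : 4 * m ≤ 6 * m),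
      Nat.cast_choose ℂ (by omega : 3 * m ≤ 4 * m), show 6 * m - 4 * m = 2 * m by omega,
      show 4 * m - 3 * m = m by omega, C, show (2 : ℂ) ^ 4 * 3 ^ 3 = 432 by norm_num,
      Nat.cast_ofNat]
    generalize (ascPochhammer ℂ m).eval (1 / 6) = A at *
    generalize (ascPochhammer ℂ m).eval (1 - 1 / 6) = B at *
    field_simp
    linear_combination h

/-! ### Analyticity and power series of the torus integrals -/

/-- The set of values of `P_l` on the torus. -/
def torusRange (l : ℕ) : Set ℂ :=
  (fun z : ℂ × ℂ => P l z.1 z.2) '' (Metric.sphere 0 1 ×ˢ Metric.sphere 0 1)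

theorem continuousOn_P {l : ℕ} (hl : l = 2 ∨ l = 3 ∨ l = 4 ∨ l = 6) :
    ContinuousOn (fun z : ℂ × ℂ => P l z.1 z.2) (Metric.sphere 0 1 ×ˢ Metric.sphere 0 1) := by
  have h1 : ∀ z ∈ (Metric.sphere 0 1 ×ˢ Metric.sphere 0 1 : Set (ℂ × ℂ)), z.1 ≠ 0 := fun z hz h => by
    have := hz.1
    rw [h] at this
    simp at this
  have h2 : ∀ z ∈ (Metric.sphere 0 1 ×ˢ Metric.sphere 0 1 : Set (ℂ × ℂ)), z.2 ≠ 0 := fun z hz h => by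
    have := hz.2
    rw [h] at this
    simp at this
  have c1 : ContinuousOn (fun z : ℂ × ℂ => z.1)
    (Metric.sphere 0 1 ×ˢ Metric.sphere 0 1) := continuousOn_fst
  have c2 : ContinuousOn (fun z : ℂ × ℂ => z.2)
    (Metric.sphere 0 1 ×ˢ Metric.sphere 0 1) := continuousOn_snd
  have c0 : ContinuousOn (fun _ : ℂ × ℂ => (1 : ℂ))
    (Metric.sphere 0 1 ×ˢ Metric.sphere 0 1) := continuousOn_const
  rcases hl with rfl | rfl | rfl | rfl
  · exact ((c1.add (c0.div c1 h1)).add c2).add (c0.div c2 h2)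
  · exact (((c1.pow 2).div c2 h2).add ((c2.pow 2).div c1 h1)).add
      (c0.div (c1.mul c2) fun z hz => mul_ne_zero (h1 z hz) (h2 z hz))
  · exact ((c1.mul (c2.pow 2)).add (c1.div (c2.pow 2) fun z hz => pow_ne_zero 2 (h2 z hz))).add
      (c0.div c1 h1)
  · exact (((c1.pow 2).div c2 h2).sub (c2.div c1 h1)).sub
      (c0.div (c1.mul c2) fun z hz => mul_ne_zero (h1 z hz) (h2 z hz))

theorem isCompact_torusRange {l : ℕ} (hl : l = 2 ∨ l = 3 ∨ l = 4 ∨ l = 6) :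
    IsCompact (torusRange l) :=
  ((isCompact_sphere 0 1).prod (isCompact_sphere 0 1)).image_of_continuousOn (continuousOn_P hl)

theorem nonvanishing_eq (l : ℕ) :
    nonvanishing l = {t : ℂ | ∀ k ∈ torusRange l, 1 - t * k ≠ 0} := by
  ext t
  constructor
  · rintro h _ ⟨z, hz, rfl⟩
    exact h z.1 z.2 (by simpa using hz.1) (by simpa using hz.2)
  · intro h x y hx hy
    exact h _ ⟨(x, y), ⟨by simpa using hx, by simpa using hy⟩, rfl⟩

theorem unitExp_mem_torus (θ : Fin 2 → ℝ) :
    (unitExp (θ 0), unitExp (θ 1)) ∈ (Metric.sphere 0 1 ×ˢ Metric.sphere 0 1 : Set (ℂ × ℂ)) :=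
  ⟨by simp [norm_unitExp], by simp [norm_unitExp]⟩

theorem continuous_P_unitExp {l : ℕ} (hl : l = 2 ∨ l = 3 ∨ l = 4 ∨ l = 6) :
    Continuous fun θ : Fin 2 → ℝ => P l (unitExp (θ 0)) (unitExp (θ 1)) :=
  (continuousOn_P hl).comp_continuous (f := fun θ : Fin 2 → ℝ => (unitExp (θ 0), unitExp (θ 1)))
    ((continuous_unitExp.comp (continuous_apply 0)).prodMk
      (continuous_unitExp.comp (continuous_apply 1))) unitExp_mem_torus

theorem differentiableOn_u {l : ℕ} (hl : l = 2 ∨ l = 3 ∨ l = 4 ∨ l = 6) :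
    DifferentiableOn ℂ (u l) (nonvanishing l) := by
  rw [nonvanishing_eq, funext (u_eq l)]
  exact differentiableOn_integral_div_one_sub_mul (isCompact_torusRange hl) (integrable_const _)
    (continuous_P_unitExp hl).aestronglyMeasurable
    (Eventually.of_forall fun θ => ⟨_, unitExp_mem_torus θ, rfl⟩)

theorem isOpen_nonvanishing {l : ℕ} (hl : l = 2 ∨ l = 3 ∨ l = 4 ∨ l = 6) :
    IsOpen (nonvanishing l) := by
  rw [nonvanishing_eq]
  exact isOpen_setOf_one_sub_mul_ne_zero (isCompact_torusRange hl)

theorem zero_mem_nonvanishing (l : ℕ) : (0 : ℂ) ∈ nonvanishing l := fun x y _ _ => by simp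

/-- Both sides are power series in `lam`; on the torus side only the powers divisible by l survive,
and there the coefficients match. -/
theorem eventually_u_eq {l : ℕ} (hl : l = 2 ∨ l = 3 ∨ l = 4 ∨ l = 6) {mu : ℂ}
    (hmu : Complex.I * mu = 1 / 2 - 1 / (l : ℂ)) (hn : ‖mu‖ < 1 / 2) :
    u l =ᶠ[𝓝 0] fun lam => (coshFactor mu)⁻¹ * ratioIntegral (cosWeight mu) (C l * lam ^ l) := by
  obtain ⟨R, hR⟩ := (isCompact_torusRange hl).isBounded.exists_norm_le
  have hl0 : 0 < l := by omega
  have e1 : ∀ᶠ lam : ℂ in 𝓝 0, ‖lam‖ * R < 1 :=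
    (isOpen_lt (by fun_prop) continuous_const).mem_nhds (by simp)
  have e2 : ∀ᶠ lam : ℂ in 𝓝 0, ‖C l * lam ^ l‖ < 1 :=
    (isOpen_lt (by fun_prop) continuous_const).mem_nhds (by simp [hl0.ne'])
  filter_upwards [e1, e2] with lam h1 h2
  have h3 := hasSum_integral_mul_pow (μ := torusMeasure) (h := fun _ => 1 / (2 * (Real.pi : ℂ)) ^ 2)
    (integrable_const _) (continuous_P_unitExp hl).aestronglyMeasurable
    (Eventually.of_forall fun θ => hR _ ⟨_, unitExp_mem_torus θ, rfl⟩) h1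
  rw [← u_eq] at h3
  change HasSum (fun n : ℕ => torusMoment l n * lam ^ n) _ at h3
  have hinj : Function.Injective fun m : ℕ => l * m := fun a b hab =>
    Nat.eq_of_mul_eq_mul_left hl0 hab
  rw [← hinj.hasSum_iff (fun n hn => by
    rw [torusMoment_eq_zero hl, zero_mul]
    rintro ⟨m, rfl⟩
    exact hn ⟨m, rfl⟩)] at h3
  have h4 := hasSum_ordinaryHypergeometric h2 hn
  refine h3.unique ?_
  convert h4 using 1
  ext m
  simp only [Function.comp]
  rw [torusMoment_eq hl, hmu, show 1 / 2 + (1 / 2 - 1 / (l : ℂ)) = 1 - 1 / (l : ℂ) by ring,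
    show 1 / 2 - (1 / 2 - 1 / (l : ℂ)) = 1 / (l : ℂ) by ring, mul_pow, ← pow_mul]
  ring

/-! ### Values of the Laurent polynomials on the torus -/

theorem unitExp_neg (θ : ℝ) : unitExp (-θ) = (unitExp θ)⁻¹ := by
  rw [unitExp, unitExp, ← Complex.exp_neg]
  push_cast
  ring_nf

theorem unitExp_pow (θ : ℝ) (n : ℕ) : unitExp θ ^ n = unitExp (n * θ) := by
  rw [unitExp, unitExp, ← Complex.exp_nat_mul]
  push_cast
  ring_nf

theorem unitExp_add_inv (θ : ℝ) : unitExp θ + (unitExp θ)⁻¹ = ((2 * Real.cos θ : ℝ) : ℂ) := by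
  rw [← unitExp_neg, unitExp, unitExp]
  push_cast
  rw [Complex.two_cos]

theorem norm_eq_one_of_pow_eq_one_of_pos {l : ℕ} (hl : 0 < l) {ζ : ℂ} (hζ : ζ ^ l = 1) : ‖ζ‖ = 1 :=
  Complex.norm_eq_one_of_pow_eq_one hζ hl.ne'

theorem exists_P_two_eq {r : ℝ} (hr : 0 < r) (hr' : r ≤ 4) {ζ : ℂ} (hζ : ζ ^ 2 = 1) :
    ∃ x y : ℂ, ‖x‖ = 1 ∧ ‖y‖ = 1 ∧ P 2 x y = ζ * r := by
  have h1 := norm_eq_one_of_pow_eq_one_of_pos two_pos hζ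
  have h0 : ζ ≠ 0 := norm_pos_iff.1 (by rw [h1]; exact one_pos)
  have hinv : ζ⁻¹ = ζ := inv_eq_of_mul_eq_one_left (by rw [← pow_two, hζ])
  set x := unitExp (Real.arccos (r / 4)) with hx
  have hxn : ‖ζ * x‖ = 1 := by rw [norm_mul, h1, hx, norm_unitExp, one_mul]
  -- As ζ = ±1, taking x = y = ζe^{iφ} gives P_2 = 4ζ cos φ.
  refine ⟨ζ * x, ζ * x, hxn, hxn, ?_⟩
  have h2 := unitExp_add_inv (Real.arccos (r / 4))
  rw [Real.cos_arccos (by linarith) (by linarith), ← hx] at h2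
  simp only [P]
  rw [one_div, mul_inv, hinv]
  push_cast at h2
  linear_combination 2 * ζ * h2

theorem exists_P_three_eq {r : ℝ} (hr : 0 < r) (hr' : r ≤ 3) {ζ : ℂ} (hζ : ζ ^ 3 = 1) :
    ∃ x y : ℂ, ‖x‖ = 1 ∧ ‖y‖ = 1 ∧ P 3 x y = ζ * r := by
  have h1 := norm_eq_one_of_pow_eq_one_of_pos three_pos hζ
  have h0 : ζ ≠ 0 := norm_pos_iff.1 (by rw [h1]; exact one_pos)
  set φ := Real.arccos ((r - 1) / 2) / 3 with hφ
  have hx0 := unitExp_ne_zero φ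
  have hxn := norm_unitExp φ
  have h2 := unitExp_add_inv (3 * φ)
  rw [show 3 * φ = Real.arccos ((r - 1) / 2) by rw [hφ]; ring,
    Real.cos_arccos (by linarith) (by linarith),
    show Real.arccos ((r - 1) / 2) = ((3 : ℕ) : ℝ) * φ by rw [hφ]; push_cast; ring,
    ← unitExp_pow] at h2
  -- At this point P_3 = ζ(1 + 2 cos 3φ), since 1/(xy) = ζ⁻² = ζ.
  refine ⟨ζ * unitExp φ, ζ * (unitExp φ)⁻¹, by rw [norm_mul, h1, hxn, one_mul],
    by rw [norm_mul, norm_inv, h1, hxn, inv_one, one_mul], ?_⟩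
  have h3 : P 3 (ζ * unitExp φ) (ζ * (unitExp φ)⁻¹) =
      ζ * (unitExp φ ^ 3 + (unitExp φ ^ 3)⁻¹) + ζ⁻¹ ^ 2 := by
    simp only [P]
    field_simp
  have h4 : ζ⁻¹ ^ 2 = ζ := by
    rw [inv_pow]
    exact inv_eq_of_mul_eq_one_left (by rw [← hζ]; ring)
  rw [h3, h2, h4]
  push_cast
  ring

theorem exists_P_four_eq {r : ℝ} (hr : 0 < r) (hr' : r ≤ 3) {ζ : ℂ} (hζ : ζ ^ 4 = 1) :
    ∃ x y : ℂ, ‖x‖ = 1 ∧ ‖y‖ = 1 ∧ P 4 x y = ζ * r := by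
  have h1 := norm_eq_one_of_pow_eq_one_of_pos four_pos hζ
  have h0 : ζ ≠ 0 := norm_pos_iff.1 (by rw [h1]; exact one_pos)
  obtain ⟨e, he, heζ⟩ : ∃ e : ℝ, |e| = 1 ∧ ζ ^ 2 = e := by
    have : (ζ ^ 2 - 1) * (ζ ^ 2 + 1) = 0 := by linear_combination hζ
    rcases mul_eq_zero.1 this with h | h
    · exact ⟨1, by simp, by push_cast; linear_combination h⟩
    · exact ⟨-1, by simp, by push_cast; linear_combination h⟩
  have hb : |e * ((r - 1) / 2)| ≤ 1 := by
    rw [abs_mul, he, one_mul, abs_le]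
    constructor <;> linarith
  set φ := Real.arccos (e * ((r - 1) / 2)) / 2 with hφ
  have hx0 := unitExp_ne_zero φ
  have h2 := unitExp_add_inv (2 * φ)
  rw [show 2 * φ = Real.arccos (e * ((r - 1) / 2)) by rw [hφ]; ring,
    Real.cos_arccos (abs_le.1 hb).1 (abs_le.1 hb).2,
    show Real.arccos (e * ((r - 1) / 2)) = ((2 : ℕ) : ℝ) * φ by rw [hφ]; push_cast; ring,
    ← unitExp_pow] at h2
  -- With x = ζ³ = ζ⁻¹ one gets P_4 = ζ(1 + 2ζ² cos 2φ); the sign e = ζ² is built into φ.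
  refine ⟨ζ ^ 3, unitExp φ, by rw [norm_pow, h1, one_pow], norm_unitExp φ, ?_⟩
  have h3 : P 4 (ζ ^ 3) (unitExp φ) =
      ζ ^ 3 * (unitExp φ ^ 2 + (unitExp φ ^ 2)⁻¹) + (ζ ^ 3)⁻¹ := by
    simp only [P]
    field_simp
  have h4 : (ζ ^ 3)⁻¹ = ζ := inv_eq_of_mul_eq_one_left (by rw [← hζ]; ring)
  rw [h3, h2, h4]
  push_cast
  rw [← heζ]
  linear_combination ζ * (r - 1) * hζ

/-- For x = e^{iθ}, the value P_6(x, y) is real when y is proportional to cos 2θ + i(sin 2θ + 2 sin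
θ). Normalizing this vector by its length √N gives the value F(θ), and the intermediate value
theorem applies between θ = 2π/3, where F ≤ 0, and θ = π, where F = 3. -/
theorem exists_P_six_eq_of_real {r : ℝ} (hr : 0 < r) (hr' : r ≤ 3) :
    ∃ x y : ℂ, ‖x‖ = 1 ∧ ‖y‖ = 1 ∧ P 6 x y = r := by
  set N : ℝ → ℝ := fun θ => (2 * Real.cos θ ^ 2 - 1) ^ 2 +
    (2 * Real.sin θ * (Real.cos θ + 1)) ^ 2 with hN
  have hNpos : ∀ θ, 0 < N θ := by
    intro θ
    have hsc := Real.sin_sq_add_cos_sq θ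
    refine lt_of_le_of_ne (by positivity) fun h => ?_
    have h1 : 2 * Real.cos θ ^ 2 - 1 = 0 := by
      refine pow_eq_zero_iff two_ne_zero |>.1 ?_
      nlinarith [sq_nonneg (2 * Real.cos θ ^ 2 - 1), sq_nonneg (2 * Real.sin θ * (Real.cos θ + 1))]
    have h2 : 2 * Real.sin θ * (Real.cos θ + 1) = 0 := by
      refine pow_eq_zero_iff two_ne_zero |>.1 ?_
      nlinarith [sq_nonneg (2 * Real.cos θ ^ 2 - 1), sq_nonneg (2 * Real.sin θ * (Real.cos θ + 1))]
    rcases mul_eq_zero.1 h2 with h3 | h3 <;> nlinarith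
  set F : ℝ → ℝ := fun θ => (1 - 8 * Real.cos θ ^ 3 + 6 * Real.cos θ) / √(N θ) with hF
  have hc : ContinuousOn F (Icc (2 * Real.pi / 3) Real.pi) := by
    refine Continuous.continuousOn (Continuous.div (by fun_prop) (by fun_prop) fun θ => ?_)
    exact (Real.sqrt_pos.2 (hNpos θ)).ne'
  have hle : 2 * Real.pi / 3 ≤ Real.pi := by linarith [Real.pi_pos]
  have hF0 : F (2 * Real.pi / 3) ≤ 0 := by
    have : Real.cos (2 * Real.pi / 3) = -1 / 2 := by
      rw [show 2 * Real.pi / 3 = Real.pi - Real.pi / 3 by ring, Real.cos_pi_sub, Real.cos_pi_div_three]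
      norm_num
    simp only [hF, this]
    exact div_nonpos_of_nonpos_of_nonneg (by norm_num) (Real.sqrt_nonneg _)
  have hF1 : F Real.pi = 3 := by
    simp only [hF, hN, Real.cos_pi, Real.sin_pi]
    norm_num
  obtain ⟨θ, -, hθ⟩ := intermediate_value_Icc hle hc
    (show r ∈ Icc (F (2 * Real.pi / 3)) (F Real.pi) from ⟨by linarith, by linarith⟩)
  have hs := Real.sqrt_pos.2 (hNpos θ)
  have hs2 := Real.sq_sqrt (hNpos θ).le
  have hsc := Real.sin_sq_add_cos_sq θ
  have hcirc : ∀ a b : ℝ, a ^ 2 + b ^ 2 = 1 →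
      ‖((a : ℂ) + b * Complex.I)‖ = 1 ∧ ((a : ℂ) + b * Complex.I)⁻¹ = a - b * Complex.I := by
    intro a b hab
    constructor
    · rw [Complex.norm_add_mul_I, hab, Real.sqrt_one]
    · refine inv_eq_of_mul_eq_one_right ?_
      have : (a : ℂ) ^ 2 + (b : ℂ) ^ 2 = 1 := by exact_mod_cast hab
      have hI := Complex.I_sq
      linear_combination this - (b : ℂ) ^ 2 * hI
  have hθ2 : 1 - 8 * Real.cos θ ^ 3 + 6 * Real.cos θ = r * √(N θ) := by
    rw [← hθ]
    simp only [hF]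
    field_simp
  simp only [hN] at hs hs2 hθ2
  generalize Real.cos θ = c at *
  generalize Real.sin θ = s at *
  generalize √((2 * c ^ 2 - 1) ^ 2 + (2 * s * (c + 1)) ^ 2) = q at *
  have hab : ((2 * c ^ 2 - 1) / q) ^ 2 + (2 * s * (c + 1) / q) ^ 2 = 1 := by
    rw [div_pow, div_pow, ← add_div, ← hs2, div_self (pow_ne_zero 2 hs.ne')]
  obtain ⟨hx1, hx2⟩ := hcirc c s (by linarith)
  obtain ⟨hy1, hy2⟩ := hcirc _ _ hab
  refine ⟨_, _, hx1, hy1, ?_⟩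
  have hP : ∀ x y : ℂ, P 6 x y = x ^ 2 * y⁻¹ - x⁻¹ * (y + y⁻¹) := by
    intro x y
    simp only [P]
    rw [one_div, mul_inv]
    ring
  rw [hP, hx2, hy2]
  have hq : (q : ℂ) ≠ 0 := by exact_mod_cast hs.ne'
  have hI := Complex.I_sq
  have hscC : (s : ℂ) ^ 2 + (c : ℂ) ^ 2 = 1 := by exact_mod_cast hsc
  have hθC : 1 - 8 * (c : ℂ) ^ 3 + 6 * c = r * q := by exact_mod_cast hθ2
  have key : ((c : ℂ) + s * Complex.I) ^ 2 * ((2 * c ^ 2 - 1) - 2 * s * (c + 1) * Complex.I) -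
      (c - s * Complex.I) * (2 * (2 * c ^ 2 - 1)) = r * q := by
    linear_combination hθC + ((s : ℂ) ^ 2 * (2 * c ^ 2 - 1) - 2 * c * s * (2 * s * (c + 1)) -
      s ^ 2 * (2 * s * (c + 1)) * Complex.I) * hI + (-(2 * (c : ℂ) ^ 2 - 1) + 4 * c * (c + 1) +
      2 * s * (c + 1) * Complex.I) * hscC
  push_cast
  field_simp
  linear_combination key

theorem exists_P_six_eq {r : ℝ} (hr : 0 < r) (hr' : r ≤ 3) {ζ : ℂ} (hζ : ζ ^ 6 = 1) :
    ∃ x y : ℂ, ‖x‖ = 1 ∧ ‖y‖ = 1 ∧ P 6 x y = ζ * r := by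
  have h1 := norm_eq_one_of_pow_eq_one_of_pos (by norm_num) hζ
  have h0 : ζ ≠ 0 := norm_pos_iff.1 (by rw [h1]; exact one_pos)
  obtain ⟨x, y, hx, hy, h⟩ := exists_P_six_eq_of_real hr hr'
  have hx0 : x ≠ 0 := norm_pos_iff.1 (by rw [hx]; exact one_pos)
  have hy0 : y ≠ 0 := norm_pos_iff.1 (by rw [hy]; exact one_pos)
  -- The symmetry P_6(ζ²x, ζ³y) = ζ P_6(x, y) for sixth roots of unity reduces to ζ = 1.
  refine ⟨ζ ^ 2 * x, ζ ^ 3 * y, by rw [norm_mul, norm_pow, h1, hx]; norm_num,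
    by rw [norm_mul, norm_pow, h1, hy]; norm_num, ?_⟩
  rw [← h]
  have h5 : (ζ ^ 5)⁻¹ = ζ := inv_eq_of_mul_eq_one_left (by rw [← hζ]; ring)
  have e1 : (ζ ^ 2 * x) ^ 2 / (ζ ^ 3 * y) = ζ * (x ^ 2 / y) := by field_simp
  have e2 : ζ ^ 3 * y / (ζ ^ 2 * x) = ζ * (y / x) := by field_simp
  have e3 : 1 / (ζ ^ 2 * x * (ζ ^ 3 * y)) = ζ * (1 / (x * y)) := by
    nth_rewrite 3 [← h5]
    field_simp
  simp only [P]
  rw [e1, e2, e3]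
  ring

/-- For l = 4 and l = 6 the bound is slack: 64 ≤ 3⁴ and 432 ≤ 3⁶. -/
theorem exists_P_eq {l : ℕ} (hl : l = 2 ∨ l = 3 ∨ l = 4 ∨ l = 6) {r : ℝ} (hr : 0 < r)
    (hr' : r ^ l ≤ ‖C l‖) {ζ : ℂ} (hζ : ζ ^ l = 1) :
    ∃ x y : ℂ, ‖x‖ = 1 ∧ ‖y‖ = 1 ∧ P l x y = ζ * r := by
  rcases hl with rfl | rfl | rfl | rfl
  · refine exists_P_two_eq hr ?_ hζ
    norm_num [C] at hr'
    nlinarith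
  · refine exists_P_three_eq hr (le_of_pow_le_pow_left₀ three_ne_zero (by norm_num) ?_) hζ
    norm_num [C] at hr' ⊢
    exact hr'
  · refine exists_P_four_eq hr (le_of_pow_le_pow_left₀ four_ne_zero (by norm_num) ?_) hζ
    norm_num [C] at hr' ⊢
    linarith
  · refine exists_P_six_eq hr (le_of_pow_le_pow_left₀ (n := 6) (by norm_num) (by norm_num) ?_) hζ
    norm_num [C] at hr' ⊢
    linarith

/-- If C_l λ^l ≥ 1, then λ^l is positive, so 1/λ = ζr with r = 1/|λ|, ζ^l = 1 and r^l ≤ C_l. Then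
1/λ is a value of P_l on the torus, against the nonvanishing of 1 - λP_l. -/
theorem mul_pow_mem_cutPlane {l : ℕ} (hl : l = 2 ∨ l = 3 ∨ l = 4 ∨ l = 6) {lam : ℂ}
    (hlam : lam ∈ nonvanishing l) : C l * lam ^ l ∈ cutPlane := by
  rintro ⟨hre, him⟩
  have hl0 : l ≠ 0 := by omega
  have hCn : C l = (‖C l‖ : ℂ) := by
    rcases hl with rfl | rfl | rfl | rfl <;> norm_num [C]
  set c : ℝ := (C l * lam ^ l).re with hc
  have hceq : C l * lam ^ l = c := Complex.ext rfl (by simpa using him)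
  have hc0 : 0 < c := one_pos.trans_le hre
  have hlam0 : lam ≠ 0 := by
    rintro rfl
    rw [zero_pow hl0, mul_zero] at hceq
    exact hc0.ne' (by exact_mod_cast hceq.symm)
  have hn : 0 < ‖lam‖ := norm_pos_iff.2 hlam0
  have hnc : ‖C l‖ * ‖lam‖ ^ l = c := by
    rw [← norm_pow, ← norm_mul, hceq, Complex.norm_real, Real.norm_of_nonneg hc0.le]
  have hr' : (‖lam‖⁻¹) ^ l ≤ ‖C l‖ := by
    rw [inv_pow, inv_le_iff_one_le_mul₀ (by positivity), hnc]
    exact hre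
  have hζ : ((‖lam‖ : ℂ) / lam) ^ l = 1 := by
    have h1 : (C l) * (‖lam‖ : ℂ) ^ l = C l * lam ^ l := by
      rw [hceq, hCn]
      exact_mod_cast hnc
    have h2 : C l ≠ 0 := by
      intro h
      rw [h, zero_mul] at hceq
      exact hc0.ne' (by exact_mod_cast hceq.symm)
    rw [div_pow, mul_left_cancel₀ h2 h1, div_self (pow_ne_zero _ hlam0)]
  obtain ⟨x, y, hx, hy, hxy⟩ := exists_P_eq hl (inv_pos.2 hn) hr' hζ
  refine hlam x y hx hy ?_
  rw [hxy]
  have : (‖lam‖ : ℂ) ≠ 0 := by exact_mod_cast hn.ne'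
  push_cast
  field_simp
  simp

/-! ### The relation with the torus integrals -/

/-- Identity theorem on the connected open set `torusDomain l`, starting from the equality of power
series at 0. -/
theorem Ve_eq_coshFactor_mul_u {l : ℕ} (hl : l = 2 ∨ l = 3 ∨ l = 4 ∨ l = 6) {mu : ℂ}
    (hmu : Complex.I * mu = 1 / 2 - 1 / (l : ℂ)) (hn : ‖mu‖ < 1 / 2) {lam : ℂ}
    (hlam : lam ∈ torusDomain l) :
    Ve (C l * lam ^ l) mu = coshFactor mu * u l lam := by
  have hsub : torusDomain l ⊆ nonvanishing l := connectedComponentIn_subset _ _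
  have hcut : MapsTo (fun lam : ℂ => C l * lam ^ l) (torusDomain l) cutPlane := fun t ht =>
    mul_pow_mem_cutPlane hl (hsub ht)
  have hopen : IsOpen (torusDomain l) := (isOpen_nonvanishing hl).connectedComponentIn
  have h1 : AnalyticOnNhd ℂ (u l) (torusDomain l) :=
    ((differentiableOn_u hl).mono hsub).analyticOnNhd hopen
  have h2 : AnalyticOnNhd ℂ (fun lam => (coshFactor mu)⁻¹ *
      ratioIntegral (cosWeight mu) (C l * lam ^ l)) (torusDomain l) := by
    refine analyticOnNhd_const.mul ?_
    exact (analyticOnNhd_ratioIntegral (integrable_cosWeight hn)).comp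
      (analyticOnNhd_const.mul (analyticOnNhd_id.pow l)) hcut
  have h3 := h1.eqOn_of_preconnected_of_eventuallyEq h2 isPreconnected_connectedComponentIn
    (mem_connectedComponentIn (zero_mem_nonvanishing l)) (eventually_u_eq hl hmu hn) hlam
  rw [h3, mul_inv_cancel_left₀ (coshFactor_ne_zero hn), Ve_eq_ratioIntegral (hcut hlam) hn]

theorem norm_torusParameter_lt {l : ℕ} (hl : l = 2 ∨ l = 3 ∨ l = 4 ∨ l = 6) :
    ‖1 / Complex.I * (1 / 2 - 1 / (l : ℂ))‖ < 1 / 2 := by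
  have h : ‖1 / Complex.I * (1 / 2 - 1 / (l : ℂ))‖ = |1 / 2 - 1 / (l : ℝ)| := by
    rw [norm_mul, norm_div, norm_one, Complex.norm_I, div_one, one_mul,
      show (1 / 2 - 1 / (l : ℂ)) = ((1 / 2 - 1 / (l : ℝ) : ℝ) : ℂ) by push_cast; rfl,
      Complex.norm_real, Real.norm_eq_abs]
  rw [h]
  rcases hl with rfl | rfl | rfl | rfl <;> norm_num [abs_lt]

/-- For this parameter, cosh πμ = cos(π/2 - π/l) = sin(π/l). -/
theorem coshFactor_torusParameter (l : ℕ) :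
    coshFactor (1 / Complex.I * (1 / 2 - 1 / (l : ℂ))) =
      (Real.pi : ℂ) ^ 2 / (2 * Complex.sin (Real.pi / l) ^ 2) := by
  rw [coshFactor]
  have h : (Real.pi : ℂ) * (1 / Complex.I * (1 / 2 - 1 / (l : ℂ))) =
      -((Real.pi / 2 - Real.pi / l) * Complex.I) := by
    rw [one_div, Complex.inv_I]
    ring
  rw [h, Complex.cosh_neg, Complex.cosh_mul_I, Complex.cos_pi_div_two_sub]

end NcHO

theorem corollary4p2 :
    -- the functions `v_{2k+2}` are well defined: the series `w_{2k+2}` converges in the unit disc,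
    -- and `v_{2k+2}` is analytic on `ℂ ∖ [1, ∞)` and equal to `(1 - z) w_{2k+2}(z)` where `|z| < 1`
    (∀ (k : ℕ) (z : ℂ), ‖z‖ < 1 → Summable (fun n : ℕ => (NcHO.J (2 * k + 2) n : ℂ) * z ^ n)) ∧
    (∀ k : ℕ, AnalyticOnNhd ℂ (NcHO.v (2 * k + 2)) NcHO.cutPlane ∧
      ∀ t : ℂ, t.re < 1 / 2 →
        NcHO.v (2 * k + 2) t = (1 - t / (t - 1)) * NcHO.w (2 * k + 2) (t / (t - 1))) ∧
    -- the hypergeometric expression of the even meta-generating function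
    (∀ t lam : ℂ, t ∈ NcHO.cutPlane → ‖lam‖ < 1 / 2 →
      Summable (NcHO.VeTerm t lam) ∧
      NcHO.Ve t lam =
        (Real.pi : ℂ) ^ 2 / (2 * Complex.cosh (Real.pi * lam) ^ 2) *
          NcHO.hyp (1 / 2 + Complex.I * lam) (1 / 2 - Complex.I * lam) 1 t) ∧
    -- the relation with the torus integrals
    (∀ l : ℕ, (l = 2 ∨ l = 3 ∨ l = 4 ∨ l = 6) → ∀ lam ∈ NcHO.torusDomain l,
      NcHO.C l * lam ^ l ∈ NcHO.cutPlane ∧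
      NcHO.Ve (NcHO.C l * lam ^ l) (1 / Complex.I * (1 / 2 - 1 / (l : ℂ))) =
        (Real.pi : ℂ) ^ 2 / (2 * Complex.sin (Real.pi / l) ^ 2) * NcHO.u l lam) := by
  refine ⟨fun k z hz => (NcHO.hasSum_J (2 * k) hz).summable,
    fun k => ⟨NcHO.analyticOnNhd_v (2 * k), fun t ht => ?_⟩,
    fun t lam ht hl => ⟨(NcHO.hasSum_VeTerm ht hl).summable, NcHO.Ve_eq ht hl⟩,
    fun l hl lam hlam => ⟨?_, ?_⟩⟩
  · rw [NcHO.v_eq (2 * k) (NcHO.mem_cutPlane_of_re_lt_one (by linarith)),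
      ← NcHO.vLocal_eq (2 * k) ht, NcHO.vLocal]
  · exact NcHO.mul_pow_mem_cutPlane hl (connectedComponentIn_subset _ _ hlam)
  · rw [NcHO.Ve_eq_coshFactor_mul_u hl ?_ (NcHO.norm_torusParameter_lt hl) hlam,
      NcHO.coshFactor_torusParameter]
    rw [← mul_assoc, mul_one_div_cancel Complex.I_ne_zero, one_mul]
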